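/- A non-ambiguous tree (NAT) $T$ is a non-empty binary tree (each vertex may have a left child and a right child) whose non-root vertices are labelled so that the left children carry each of the labels $1,\dots,\ell$ exactly once, the right children carry each of the labels $1,\dots,r$ exactly once ($\ell$ and $r$ being the numbers of left and of right children), and, whenever $U$ is a proper ancestor of $V$ and both are left children or both are right children, the label of $U$ is strictly greater than that of $V$. Put $w_L(T)=\ell+1$ and $w_R(T)=r+1$; the geometric size of $T$ is $w_L(T)\times w_R(T)$. The geometric presentation of $T$ places its vertices in a rectangle with rows $0,\dots,w_L(T)-1$ (top to bottom) and columns $0,\dots,w_R(T)-1$ (left to right): the root is in row $0$ and column $0$, a left child with label $a$ is in row $w_L(T)-a$ and in the column of its parent, and a right child with label $a$ is in column $w_R(T)-a$ and in the row of its parent. Let $w_L,w_R$ be positive integers and let $T$ be a NAT of geometric size $w_L\times w_R$. Number the edges of the south-east border of the rectangle: the bottom edges of the columns, from left to right, by $0,\dots,w_R-1$, then the right edges of the rows, from bottom to top, by $w_R,\dots,w_R+w_L-1$. Define $\psi(T)$ as the following self-map of $\{0,\dots,w_L+w_R-1\}$. If $i$ is the number of a horizontal edge, start at the topmost point of its column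 and move right; if $i$ is the number of a vertical edge, start at the leftmost point of its row and move down. Move to the closest point of $T$ in the current direction, then switch between right and down, and so on alternately; when there is no further point in the current direction, exit through the border edge in that direction. Then $\psi(T)(i)$ is the number of this last edge. Then $\psi$ is a bijection from the set of NATs of geometric size $w_L\times w_R$ onto the set of cyclic permutations $\sigma$ of $\{0,\dots,w_L+w_R-1\}$ (one cycle through all elements) whose set of excedance positions $\{i : \sigma(i)>i\}$ is exactly $\{0,\dots,w_R-1\}$. Moreover, replace each $i\in\{0,\dots,w_R-1\}$ by the blue integer $w_R-i$ and each $i\in\{w_R,\dots,w_R+w_L-1\}$ by the red integer $i-w_R+1$. After this relabelling, $\psi$ is a bijection from the set of NATs of geometric size $w_L\times w_R$ onto the set of 2-coloured block-decreasing cycles of size $w_L\times w_R$, that is, cyclic permutations of the set of red integers $1,\dots,w_L$ and blue integers $1,\dots,w_R$ (one cycle through all elements) such that, whenever the image of an element $a$ is an element $b$ of the same colour, $a>b$. -/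

import Mathlib

/-- The two kinds of children in a binary tree. -/
inductive Side where
  | L : Side
  | R : Side
  deriving DecidableEq

/-- The multiset of labels carried by the vertices of kind `c` in a labelled binary tree
whose own root is a child of kind `d`. -/
def sideLabels (c : Side) : Side → BinaryTree ℕ → Multiset ℕ
  | _, .nil => 0
  | d, .node a l r =>
      (if d = c then {a} else 0) + sideLabels c .L l + sideLabels c .R r

/-- In a labelled binary tree whose own root is a child of kind `d`: whenever a vertex `U` is
a proper ancestor of a vertex `V` of the same kind, the label of `U` is strictly greater than
the label of `V`. -/
def AncestorsGreater : Side → BinaryTree ℕ → Prop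
  | _, .nil => True
  | d, .node a l r =>
      (∀ b ∈ sideLabels d .L l + sideLabels d .R r, b < a) ∧
        AncestorsGreater .L l ∧ AncestorsGreater .R r

/-- A (non-empty) non-ambiguous tree: a binary tree, given by the left and right subtrees of
its (unlabelled) root, all of whose non-root vertices are labelled. The left (resp. right)
children carry each of the labels `1, …, |LV|` (resp. `1, …, |RV|`) exactly once, and labels
of left (resp. right) children strictly decrease from ancestors to descendants. -/
structure NonAmbiguousTree where
  left : BinaryTree ℕ
  right : BinaryTree ℕ
  leftLabels_eq :
    sideLabels .L .L left + sideLabels .L .R right =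
      (Finset.Icc 1 (sideLabels .L .L left + sideLabels .L .R right).card).val
  rightLabels_eq :
    sideLabels .R .L left + sideLabels .R .R right =
      (Finset.Icc 1 (sideLabels .R .L left + sideLabels .R .R right).card).val
  left_greater : AncestorsGreater .L left
  right_greater : AncestorsGreater .R right

namespace NonAmbiguousTree

/-- `w_L(T) = |LV(T)| + 1`, the number of rows of the geometric presentation. -/
def wL (T : NonAmbiguousTree) : ℕ :=
  (sideLabels .L .L T.left + sideLabels .L .R T.right).card + 1

/-- `w_R(T) = |RV(T)| + 1`, the number of columns of the geometric presentation. -/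
def wR (T : NonAmbiguousTree) : ℕ :=
  (sideLabels .R .L T.left + sideLabels .R .R T.right).card + 1

end NonAmbiguousTree

/-- The positions, in label coordinates, of the vertices of a labelled subtree whose parent
vertex has position `(x, y)`. The first coordinate of a left child is its label and its second
coordinate is that of its closest ancestor which is a right child or the root of the whole
tree (equivalently, that of its parent); symmetrically for right children. -/
def labelPositions : Side → ℕ → ℕ → BinaryTree ℕ → Finset (ℕ × ℕ)
  | _, _, _, .nil => ∅
  | .L, _, y, .node a l r =>
      insert (a, y) (labelPositions .L a y l ∪ labelPositions .R a y r)
  | .R, x, _, .node a l r =>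
      insert (x, a) (labelPositions .L x a l ∪ labelPositions .R x a r)

namespace NonAmbiguousTree

/-- The geometric presentation of `T`: the root, which has label coordinates
`(|LV| + 1, |RV| + 1)`, and all other vertices, after the change of coordinates
`(x, y) ↦ (|LV| + 1 - x, |RV| + 1 - y)`. A point `(x, y)` lies in row `x` (rows are numbered
from `0` at the top) and in column `y` (columns are numbered from `0` at the left). -/
def geometricPresentation (T : NonAmbiguousTree) : Finset (ℕ × ℕ) :=
  (insert (T.wL, T.wR)
    (labelPositions .L T.wL T.wR T.left ∪ labelPositions .R T.wL T.wR T.right)).image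
      fun p => (T.wL - p.1, T.wR - p.2)

/-- The geometric presentation as a set of cells of the rectangle with `m` rows and `n`
columns (used when `T` has geometric size `m × n`). -/
def cells (m n : ℕ) (T : NonAmbiguousTree) : Finset (Fin m × Fin n) :=
  Finset.univ.filter fun p => (p.1.val, p.2.val) ∈ T.geometricPresentation

end NonAmbiguousTree

/-- The edges of the south-east border of the rectangle with `m` rows and `n` columns: one
horizontal edge at the bottom of each column, one vertical edge at the right end of each
row. -/
inductive BorderEdge (m n : ℕ) where
  | south (y : Fin n) : BorderEdge m n
  | east (x : Fin m) : BorderEdge m n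

/-- The numbering of the south-east border, starting with `0` at the westmost edge: the
horizontal edges from left to right get `0, …, n - 1`, then the vertical edges from bottom to
top get `n, …, n + m - 1`. -/
def borderNumber (m n : ℕ) : BorderEdge m n ≃ Fin (m + n) where
  toFun
    | .south y => ⟨y, by omega⟩
    | .east x => ⟨n + (m - 1 - x), by omega⟩
  invFun i :=
    if h : i.val < n then .south ⟨i, h⟩ else .east ⟨m - 1 - (i - n), by omega⟩
  left_inv e := by
    cases e with
    | south y => simp
    | east x =>
      have hx := x.isLt
      simp only [BorderEdge.east.injEq, Fin.ext_iff, add_lt_iff_neg_left, not_lt_zero,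
        dif_neg, not_false_eq_true]
      omega
  right_inv i := by
    have hi := i.isLt
    by_cases h : i.val < n
    · simp [h]
    · simp only [h, dif_neg, not_false_eq_true, Fin.ext_iff]
      omega

/-- The two directions of a zigzag. -/
inductive Direction where
  | down : Direction
  | right : Direction

/-- The zigzag path in the set of points `A` that leaves the cell `(x, y)` in the given
direction: it goes to the closest point of `A` in that direction, from there on in the other
direction, and so on alternately. When there is no further point of `A` in the current
direction it reaches the border edge in that direction, which is the value returned. -/
def zigzag {m n : ℕ} (A : Finset (Fin m × Fin n)) :
    Direction → Fin m → Fin n → BorderEdge m n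
  | .down, x, y =>
      if h : (Finset.univ.filter fun x' => x < x' ∧ (x', y) ∈ A).Nonempty then
        zigzag A .right ((Finset.univ.filter fun x' => x < x' ∧ (x', y) ∈ A).min' h) y
      else .south y
  | .right, x, y =>
      if h : (Finset.univ.filter fun y' => y < y' ∧ (x, y') ∈ A).Nonempty then
        zigzag A .down x ((Finset.univ.filter fun y' => y < y' ∧ (x, y') ∈ A).min' h)
      else .east x
  termination_by _ x y => (m - x.val) + (n - y.val)
  decreasing_by
    · have h1 := (Finset.mem_filter.1 (Finset.min'_mem _ h)).2.1
      rw [Fin.lt_def] at h1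
      omega
    · have h1 := (Finset.mem_filter.1 (Finset.min'_mem _ h)).2.1
      rw [Fin.lt_def] at h1
      omega

/-- The border edge associated with a border edge by the zigzag construction. From a
horizontal edge, start at the topmost point of the column and zigzag, first to the right.
From a vertical edge, start at the leftmost point of the row and zigzag, first down.
An edge whose line contains no point is sent to itself. -/
def zigzagImage {m n : ℕ} (A : Finset (Fin m × Fin n)) : BorderEdge m n → BorderEdge m n
  | .south y =>
      if h : (Finset.univ.filter fun x => (x, y) ∈ A).Nonempty then
        zigzag A .right ((Finset.univ.filter fun x => (x, y) ∈ A).min' h) y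
      else .south y
  | .east x =>
      if h : (Finset.univ.filter fun y => (x, y) ∈ A).Nonempty then
        zigzag A .down x ((Finset.univ.filter fun y => (x, y) ∈ A).min' h)
      else .east x

/-- The zigzag map `ψ` (no column deleted), for trees of geometric size `m × n`, as a
self-map of `{0, …, m + n - 1}`. -/
def psi (m n : ℕ) (T : NonAmbiguousTree) : Fin (m + n) → Fin (m + n) :=
  fun i => borderNumber m n (zigzagImage (T.cells m n) ((borderNumber m n).symm i))

/-- Red integers `1, …, m` and blue integers `1, …, n`; the element with index `k` stands for
the integer `k + 1` of its colour. -/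
inductive Coloured (m n : ℕ) where
  | red (k : Fin m) : Coloured m n
  | blue (k : Fin n) : Coloured m n

/-- The recolouring: `i ∈ {0, …, n - 1}` becomes the blue integer `n - i`, and
`i ∈ {n, …, n + m - 1}` becomes the red integer `i - n + 1`. -/
def recolour (m n : ℕ) : Fin (m + n) ≃ Coloured m n where
  toFun i :=
    if h : i.val < n then .blue ⟨n - i - 1, by omega⟩ else .red ⟨i - n, by omega⟩
  invFun
    | .red k => ⟨n + k, by omega⟩
    | .blue k => ⟨n - (k + 1), by omega⟩
  left_inv i := by
    have hi := i.isLt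
    by_cases h : i.val < n
    · simp only [h, dif_pos, Fin.ext_iff]
      omega
    · simp only [h, dif_neg, not_false_eq_true, Fin.ext_iff]
      omega
  right_inv c := by
    cases c with
    | red k => simp
    | blue k =>
      have hk := k.isLt
      have h : n - (k.val + 1) < n := by omega
      simp only [h, dif_pos, Coloured.blue.injEq, Fin.ext_iff]
      omega

/-- A 2-coloured block-decreasing cycle of size `m × n`: a cycle through all the elements
such that, if the image of `a` is an element `b` of the same colour, then `a > b`. -/
def IsBlockDecreasingCycle {m n : ℕ} (σ : Equiv.Perm (Coloured m n)) : Prop :=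
  σ.IsCycleOn Set.univ ∧
    (∀ a b : Fin m, σ (.red a) = .red b → b < a) ∧
    (∀ a b : Fin n, σ (.blue a) = .blue b → b < a)

/-! The proof grows the point set of a tree one point at a time and tracks the zigzag map as a
product of transpositions.

Suppose a point is added that is last both in its row and in its column. A zigzag path changes only
if it used to exit through one of the two border edges of that row and column: it now turns at the
new point and exits through the other edge. The zigzag map is thus multiplied on the left by the
transposition of these edges (`zigzagImage_insert`). Without points the map is the identity.

In the geometric presentation of a tree, the rightmost point of the bottom row is the root or a
leaf. If its parent is above, it is alone in its row; if its parent is to the left, it is alone in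
its column. Removing it repeatedly shows that the point set arises from the root by steps that open
a new bottom row or a new column (`Grown`, `IsNonAmbiguous.exists_grown`). Each step inserts one
fixed border edge into the cycle, so the result is a single cycle. Moreover, images of column edges
that are column edges lie further right, and images of row edges that are row edges lie further down
(`Grown.isBorderCycle`).

Conversely, such a cycle `σ` reveals its last step. The edge of the bottom row `x` goes to a column
`y₁`. If row `x` is the image of a column to the right of `y₁`, that column was added last. If it is
the image of `y₁` itself, only the root is present. Otherwise row `x` was added last, in column
`y₁`. Undoing the step preserves the conditions on the cycle, so induction gives existence
(`IsBorderCycle.exists_grown`) and uniqueness (`Grown.eq_of_grown`) of the grown point set.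

Point sets correspond to trees. The children of a vertex are the nearest points below and to the
right, so the points determine the tree (`IsSubtreeOf.eq`). Each growth step attaches a left leaf or
a right leaf, so every grown point set comes from a tree (`Grown.exists_tree`). Both claimed
descriptions of the image are the same cycle condition, read in border numbers or in coloured
integers. -/

noncomputable instance BorderEdge.instDecidableEq (m n : ℕ) : DecidableEq (BorderEdge m n) :=
  Classical.decEq _

/-! ### Zigzag paths and the effect of a new point. -/

section Zigzag

variable {m n : ℕ} {A : Finset (Fin m × Fin n)}

theorem zigzag_down_exit {x : Fin m} {y : Fin n} (h : ∀ z, x < z → (z, y) ∉ A) :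
    zigzag A .down x y = .south y := by
  rw [zigzag, dif_neg]
  rintro ⟨z, hz⟩
  exact h z (Finset.mem_filter.1 hz).2.1 (Finset.mem_filter.1 hz).2.2

theorem zigzag_right_exit {x : Fin m} {y : Fin n} (h : ∀ z, y < z → (x, z) ∉ A) :
    zigzag A .right x y = .east x := by
  rw [zigzag, dif_neg]
  rintro ⟨z, hz⟩
  exact h z (Finset.mem_filter.1 hz).2.1 (Finset.mem_filter.1 hz).2.2

theorem Finset.min'_eq_of_forall {α : Type*} [LinearOrder α] {s : Finset α} (h : s.Nonempty)
    {a : α} (ha : a ∈ s) (hmin : ∀ z ∈ s, ¬ z < a) : s.min' h = a :=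
  le_antisymm (s.min'_le a ha) (not_lt.1 (hmin _ (s.min'_mem h)))

theorem zigzag_down_step {x x' : Fin m} {y : Fin n} (hx : x < x') (hA : (x', y) ∈ A)
    (hmin : ∀ z, x < z → z < x' → (z, y) ∉ A) :
    zigzag A .down x y = zigzag A .right x' y := by
  have hmem : x' ∈ Finset.univ.filter fun z => x < z ∧ (z, y) ∈ A := by simp [hx, hA]
  rw [zigzag.eq_1, dif_pos (show Finset.Nonempty _ from ⟨_, hmem⟩), Finset.min'_eq_of_forall _ hmem]
  intro z hz hlt
  exact hmin z (Finset.mem_filter.1 hz).2.1 hlt (Finset.mem_filter.1 hz).2.2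

theorem zigzag_right_step {x : Fin m} {y y' : Fin n} (hy : y < y') (hA : (x, y') ∈ A)
    (hmin : ∀ z, y < z → z < y' → (x, z) ∉ A) :
    zigzag A .right x y = zigzag A .down x y' := by
  have hmem : y' ∈ Finset.univ.filter fun z => y < z ∧ (x, z) ∈ A := by simp [hy, hA]
  rw [zigzag.eq_2, dif_pos (show Finset.Nonempty _ from ⟨_, hmem⟩), Finset.min'_eq_of_forall _ hmem]
  intro z hz hlt
  exact hmin z (Finset.mem_filter.1 hz).2.1 hlt (Finset.mem_filter.1 hz).2.2

theorem zigzagImage_south {x : Fin m} {y : Fin n} (hA : (x, y) ∈ A)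
    (hmin : ∀ z, z < x → (z, y) ∉ A) :
    zigzagImage A (.south y) = zigzag A .right x y := by
  have hmem : x ∈ Finset.univ.filter fun z => (z, y) ∈ A := by simp [hA]
  rw [zigzagImage, dif_pos (show Finset.Nonempty _ from ⟨_, hmem⟩), Finset.min'_eq_of_forall _ hmem]
  intro z hz hlt
  exact hmin z hlt (Finset.mem_filter.1 hz).2

theorem zigzagImage_east {x : Fin m} {y : Fin n} (hA : (x, y) ∈ A)
    (hmin : ∀ z, z < y → (x, z) ∉ A) :
    zigzagImage A (.east x) = zigzag A .down x y := by
  have hmem : y ∈ Finset.univ.filter fun z => (x, z) ∈ A := by simp [hA]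
  rw [zigzagImage, dif_pos (show Finset.Nonempty _ from ⟨_, hmem⟩), Finset.min'_eq_of_forall _ hmem]
  intro z hz hlt
  exact hmin z hlt (Finset.mem_filter.1 hz).2

theorem zigzagImage_south_of_empty {y : Fin n} (h : ∀ z, (z, y) ∉ A) :
    zigzagImage A (.south y) = .south y := by
  rw [zigzagImage, dif_neg]
  rintro ⟨z, hz⟩
  exact h z (Finset.mem_filter.1 hz).2

theorem zigzagImage_east_of_empty {x : Fin m} (h : ∀ z, (x, z) ∉ A) :
    zigzagImage A (.east x) = .east x := by
  rw [zigzagImage, dif_neg]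
  rintro ⟨z, hz⟩
  exact h z (Finset.mem_filter.1 hz).2

/-- Either no element of a finite linear order satisfies `p`, or there is a least one. -/
theorem forall_not_or_exists_least {α : Type*} [LinearOrder α] [Finite α] (p : α → Prop) :
    (∀ z, ¬ p z) ∨ ∃ a, p a ∧ ∀ z, z < a → ¬ p z := by
  by_cases h : ∃ z, p z
  · right
    obtain ⟨a, ha, hmin⟩ := WellFounded.has_min (wellFounded_lt (α := α)) {z | p z} h
    exact ⟨a, ha, fun z hz hp => hmin z hp hz⟩
  · left
    exact fun z hz => h ⟨z, hz⟩

open Equiv in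
/-- A new point that is the last one in its row and in its column exchanges the two paths that
reached the corresponding border edges. -/
theorem zigzag_insert {x : Fin m} {y : Fin n} (hA : (x, y) ∉ A)
    (hcol : ∀ z, x < z → (z, y) ∉ A) (hrow : ∀ z, y < z → (x, z) ∉ A) (k : ℕ) :
    ∀ (u : Fin m) (v : Fin n), (m - u.val) + (n - v.val) < k →
      ((v = y → u < x) → zigzag (insert (x, y) A) .down u v =
        swap (.east x) (.south y) (zigzag A .down u v)) ∧
      ((u = x → v < y) → zigzag (insert (x, y) A) .right u v =
        swap (.east x) (.south y) (zigzag A .right u v)) := by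
  have hcol' : ∀ z, (z, y) ∈ A → z < x := fun z hz => by
    rcases lt_trichotomy z x with h | h | h
    · exact h
    · exact absurd (h ▸ hz) hA
    · exact absurd hz (hcol z h)
  have hrow' : ∀ z, (x, z) ∈ A → z < y := fun z hz => by
    rcases lt_trichotomy z y with h | h | h
    · exact h
    · exact absurd (h ▸ hz) hA
    · exact absurd hz (hrow z h)
  -- `k` bounds the sum of the distances to the two far sides of the rectangle, which each leg of a
  -- path shortens; both directions are treated together because they alternate. The provisos say
  -- that a start in line with the new point lies before it. They persist along the path because all
  -- old points of row `x` and of column `y` precede the new point.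
  induction k with
  | zero => intro u v h; omega
  | succ k ih =>
    intro u v hk
    constructor
    · intro huv
      rcases forall_not_or_exists_least fun z => u < z ∧ (z, v) ∈ A with h | ⟨w, ⟨huw, hwA⟩, hmin⟩
      · rw [zigzag_down_exit (A := A) fun z h1 h2 => h z ⟨h1, h2⟩]
        by_cases hv : v = y
        · subst hv
          rw [zigzag_down_step (huv rfl) (Finset.mem_insert_self _ _), zigzag_right_exit,
            swap_apply_right]
          · intro z hz hmem
            rcases Finset.mem_insert.1 hmem with h' | h'
            · simp only [Prod.mk.injEq, true_and] at h'
              exact hz.ne' h'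
            · exact hrow z hz h'
          · intro z hz hzx hmem
            rcases Finset.mem_insert.1 hmem with h' | h'
            · simp only [Prod.mk.injEq, and_true] at h'
              exact hzx.ne h'
            · exact h z ⟨hz, h'⟩
        · rw [swap_apply_of_ne_of_ne (by simp) (by simpa using hv)]
          apply zigzag_down_exit
          intro z hz hmem
          rcases Finset.mem_insert.1 hmem with h' | h'
          · exact hv (Prod.ext_iff.1 h').2
          · exact h z ⟨hz, h'⟩
      · have hwy : w = x → v < y := fun hw => hrow' v (hw ▸ hwA)
        rw [zigzag_down_step huw hwA fun z h1 h2 h3 => hmin z h2 ⟨h1, h3⟩,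
          zigzag_down_step huw (Finset.mem_insert_of_mem hwA)]
        · exact (ih w v (by have := w.isLt; rw [Fin.lt_def] at huw; omega)).2 hwy
        · intro z h1 h2 hmem
          rcases Finset.mem_insert.1 hmem with h' | h'
          · simp only [Prod.mk.injEq] at h'
            obtain ⟨rfl, rfl⟩ := h'
            exact lt_asymm h2 (hcol' w hwA)
          · exact hmin z h2 ⟨h1, h'⟩
    · intro huv
      rcases forall_not_or_exists_least fun z => v < z ∧ (u, z) ∈ A with h | ⟨w, ⟨huw, hwA⟩, hmin⟩
      · rw [zigzag_right_exit (A := A) fun z h1 h2 => h z ⟨h1, h2⟩]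
        by_cases hv : u = x
        · subst hv
          rw [zigzag_right_step (huv rfl) (Finset.mem_insert_self _ _), zigzag_down_exit,
            swap_apply_left]
          · intro z hz hmem
            rcases Finset.mem_insert.1 hmem with h' | h'
            · simp only [Prod.mk.injEq, and_true] at h'
              exact hz.ne' h'
            · exact hcol z hz h'
          · intro z hz hzx hmem
            rcases Finset.mem_insert.1 hmem with h' | h'
            · simp only [Prod.mk.injEq, true_and] at h'
              exact hzx.ne h'
            · exact h z ⟨hz, h'⟩
        · rw [swap_apply_of_ne_of_ne (by simpa using hv) (by simp)]
          apply zigzag_right_exit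
          intro z hz hmem
          rcases Finset.mem_insert.1 hmem with h' | h'
          · exact hv (Prod.ext_iff.1 h').1
          · exact h z ⟨hz, h'⟩
      · have hwy : w = y → u < x := fun hw => hcol' u (hw ▸ hwA)
        rw [zigzag_right_step huw hwA fun z h1 h2 h3 => hmin z h2 ⟨h1, h3⟩,
          zigzag_right_step huw (Finset.mem_insert_of_mem hwA)]
        · exact (ih u w (by have := w.isLt; rw [Fin.lt_def] at huw; omega)).1 hwy
        · intro z h1 h2 hmem
          rcases Finset.mem_insert.1 hmem with h' | h'
          · simp only [Prod.mk.injEq] at h'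
            obtain ⟨rfl, rfl⟩ := h'
            exact lt_asymm h2 (hrow' w hwA)
          · exact hmin z h2 ⟨h1, h'⟩

-- The new point does not replace the starting point of any nonempty row or column, since it comes
-- last there; after the start, `zigzag_insert` applies. If row `x` or column `y` was empty, its
-- edge was fixed, and the path from the new point leaves at once through the other edge.
open Equiv in
theorem zigzagImage_insert {x : Fin m} {y : Fin n} (hA : (x, y) ∉ A)
    (hcol : ∀ z, x < z → (z, y) ∉ A) (hrow : ∀ z, y < z → (x, z) ∉ A) (e : BorderEdge m n) :
    zigzagImage (insert (x, y) A) e = swap (.east x) (.south y) (zigzagImage A e) := by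
  have hcol' : ∀ z, (z, y) ∈ A → z < x := fun z hz => by
    rcases lt_trichotomy z x with h | h | h
    · exact h
    · exact absurd (h ▸ hz) hA
    · exact absurd hz (hcol z h)
  have hrow' : ∀ z, (x, z) ∈ A → z < y := fun z hz => by
    rcases lt_trichotomy z y with h | h | h
    · exact h
    · exact absurd (h ▸ hz) hA
    · exact absurd hz (hrow z h)
  cases e with
  | south v =>
    rcases forall_not_or_exists_least fun z => (z, v) ∈ A with h | ⟨w, hwA, hmin⟩
    · rw [zigzagImage_south_of_empty h]
      by_cases hv : v = y
      · subst hv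
        rw [zigzagImage_south (Finset.mem_insert_self _ _), zigzag_right_exit, swap_apply_right]
        · intro z hz hmem
          rcases Finset.mem_insert.1 hmem with h' | h'
          · simp only [Prod.mk.injEq, true_and] at h'
            exact hz.ne' h'
          · exact hrow z hz h'
        · intro z hzx hmem
          rcases Finset.mem_insert.1 hmem with h' | h'
          · simp only [Prod.mk.injEq, and_true] at h'
            exact hzx.ne h'
          · exact h z h'
      · rw [swap_apply_of_ne_of_ne (by simp) (by simpa using hv)]
        apply zigzagImage_south_of_empty
        intro z hmem
        rcases Finset.mem_insert.1 hmem with h' | h'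
        · exact hv (Prod.ext_iff.1 h').2
        · exact h z h'
    · rw [zigzagImage_south hwA hmin, zigzagImage_south (Finset.mem_insert_of_mem hwA)]
      · exact (zigzag_insert hA hcol hrow _ w v (Nat.lt_succ_self _)).2
          fun hw => hrow' v (hw ▸ hwA)
      · intro z h2 hmem
        rcases Finset.mem_insert.1 hmem with h' | h'
        · simp only [Prod.mk.injEq] at h'
          obtain ⟨rfl, rfl⟩ := h'
          exact lt_asymm h2 (hcol' w hwA)
        · exact hmin z h2 h'
  | east u =>
    rcases forall_not_or_exists_least fun z => (u, z) ∈ A with h | ⟨w, hwA, hmin⟩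
    · rw [zigzagImage_east_of_empty h]
      by_cases hv : u = x
      · subst hv
        rw [zigzagImage_east (Finset.mem_insert_self _ _), zigzag_down_exit, swap_apply_left]
        · intro z hz hmem
          rcases Finset.mem_insert.1 hmem with h' | h'
          · simp only [Prod.mk.injEq, and_true] at h'
            exact hz.ne' h'
          · exact hcol z hz h'
        · intro z hzx hmem
          rcases Finset.mem_insert.1 hmem with h' | h'
          · simp only [Prod.mk.injEq, true_and] at h'
            exact hzx.ne h'
          · exact h z h'
      · rw [swap_apply_of_ne_of_ne (by simpa using hv) (by simp)]
        apply zigzagImage_east_of_empty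
        intro z hmem
        rcases Finset.mem_insert.1 hmem with h' | h'
        · exact hv (Prod.ext_iff.1 h').1
        · exact h z h'
    · rw [zigzagImage_east hwA hmin, zigzagImage_east (Finset.mem_insert_of_mem hwA)]
      · exact (zigzag_insert hA hcol hrow _ u w (Nat.lt_succ_self _)).1
          fun hw => hcol' u (hw ▸ hwA)
      · intro z h2 hmem
        rcases Finset.mem_insert.1 hmem with h' | h'
        · simp only [Prod.mk.injEq] at h'
          obtain ⟨rfl, rfl⟩ := h'
          exact lt_asymm h2 (hrow' w hwA)
        · exact hmin z h2 h'

theorem zigzagImage_empty (e : BorderEdge m n) : zigzagImage ∅ e = e := by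
  cases e with
  | south y => exact zigzagImage_south_of_empty (by simp)
  | east x => exact zigzagImage_east_of_empty (by simp)

end Zigzag

/-! ### Inserting a fixed point into a cycle and removing it again. -/

open Equiv Equiv.Perm

/-- It suffices to control single steps of `f`. Besides transporting cycles, this serves with `g =
1` to show that an invariant predicate is constant on a cycle. -/
theorem Equiv.Perm.SameCycle.map {α β : Type*} {f : Perm α} {g : Perm β} {π : α → β}
    (h : ∀ e, SameCycle g (π e) (π (f e))) {x y : α} (hxy : SameCycle f x y) :
    SameCycle g (π x) (π y) := by
  obtain ⟨k, rfl⟩ := hxy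
  induction k using Int.induction_on with
  | zero => exact SameCycle.refl _ _
  | succ i ih =>
    rw [add_comm, zpow_add, zpow_one, Perm.mul_apply]
    exact ih.trans (h _)
  | pred i ih =>
    refine ih.trans ?_
    have := h ((f ^ (-(i : ℤ) - 1)) x)
    rw [← Perm.mul_apply, ← zpow_one_add] at this
    simpa using this.symm

section Insertion

variable {α : Type*} [DecidableEq α] {f : Perm α} {a b : α}

/-- Composing with `swap a b` inserts the fixed point `a` into a cycle, just before `b`. -/
theorem sameCycle_swap_mul (ha : f a = a) {x y : α} (h : SameCycle f x y) :
    SameCycle (swap a b * f) x y := by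
  refine h.map (π := id) fun e => ?_
  by_cases hb : f e = b
  · have h1 : (swap a b * f) e = a := by simp [hb]
    have h2 : (swap a b * f) a = b := by simp [ha]
    simp only [id, hb]
    have h3 : SameCycle (swap a b * f) e ((swap a b * f) e) :=
      sameCycle_apply_right.2 SameCycle.rfl
    have h4 : SameCycle (swap a b * f) a ((swap a b * f) a) :=
      sameCycle_apply_right.2 SameCycle.rfl
    rw [h1] at h3
    rw [h2] at h4
    exact h3.trans h4
  · by_cases hea : f e = a
    · have : e = a := f.injective (hea.trans ha.symm)
      subst this
      simp [ha, SameCycle.refl]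
    · have h1 : (swap a b * f) e = f e := by
        rw [Perm.mul_apply, swap_apply_of_ne_of_ne hea hb]
      simp only [id]
      rw [← h1, sameCycle_apply_right]

theorem sameCycle_swap_mul_self (ha : f a = a) : SameCycle (swap a b * f) a b := by
  have h2 : (swap a b * f) a = b := by simp [ha]
  nth_rewrite 2 [← h2]
  rw [sameCycle_apply_right]

/-- Collapsing `a` onto `b` turns each step of the enlarged cycle into a step of `f` or into no step
at all. -/
theorem SameCycle.of_swap_mul (ha : f a = a) {x y : α} (hx : x ≠ a) (hy : y ≠ a)
    (h : SameCycle (swap a b * f) x y) : SameCycle f x y := by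
  have := h.map (g := f) (π := fun e => if e = a then b else e) fun e => ?_
  · simpa [hx, hy] using this
  · by_cases hea : e = a
    · subst hea
      simp [ha, SameCycle.refl]
    · have hfa : f e ≠ a := fun h => hea (f.injective (h.trans ha.symm))
      by_cases hb : f e = b
      · simp only [hea, if_false, Perm.mul_apply, hb, swap_apply_right, if_true]
        rw [← hb, sameCycle_apply_right]
      · rw [Perm.mul_apply, swap_apply_of_ne_of_ne hfa hb, if_neg hea, if_neg hfa,
          sameCycle_apply_right]

end Insertion

/-! ### Grown point sets and their border cycles. -/

section Core

variable {m n : ℕ}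

/-- The border edges of the rows in `X` and of the columns in `Y`. -/
def borderEdges (X : Finset (Fin m)) (Y : Finset (Fin n)) : BorderEdge m n → Prop
  | .south y => y ∈ Y
  | .east x => x ∈ X

@[simp] theorem borderEdges_south {X : Finset (Fin m)} {Y : Finset (Fin n)} {y : Fin n} :
    borderEdges X Y (.south y) ↔ y ∈ Y := Iff.rfl

@[simp] theorem borderEdges_east {X : Finset (Fin m)} {Y : Finset (Fin n)} {x : Fin m} :
    borderEdges X Y (.east x) ↔ x ∈ X := Iff.rfl

/-- `σ` is a cycle on the border edges of the rows in `X` and of the columns in `Y`, fixes all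
other border edges, and moves rightwards from column to column and downwards from row to row. -/
structure IsBorderCycle (σ : Perm (BorderEdge m n)) (X : Finset (Fin m)) (Y : Finset (Fin n)) :
    Prop where
  fixed : ∀ e, ¬ borderEdges X Y e → σ e = e
  sameCycle : ∀ e e', borderEdges X Y e → borderEdges X Y e' → SameCycle σ e e'
  south_lt : ∀ y ∈ Y, ∀ y', σ (.south y) = .south y' → y < y'
  east_lt : ∀ x ∈ X, ∀ x', σ (.east x) = .east x' → x < x'

/-- `Grown x₀ y₀ A σ X Y`: the point set `A`, with rows `X` and columns `Y`, arises from the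
point `(x₀, y₀)` by successively adding a point in an old column and in a new bottom row, or a
point in the bottom row, to the right of its points, and in a new column; `σ` is the product of
the corresponding transpositions. -/
inductive Grown (x₀ : Fin m) (y₀ : Fin n) :
    Finset (Fin m × Fin n) → Perm (BorderEdge m n) → Finset (Fin m) → Finset (Fin n) → Prop
  | root : Grown x₀ y₀ {(x₀, y₀)} (swap (.east x₀) (.south y₀)) {x₀} {y₀}
  | row {A σ X Y} {x : Fin m} {y : Fin n} (h : Grown x₀ y₀ A σ X Y) (hx : ∀ x' ∈ X, x' < x)
      (hy : y ∈ Y) :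
      Grown x₀ y₀ (insert (x, y) A) (swap (.east x) (.south y) * σ) (insert x X) Y
  | column {A σ X Y} {x : Fin m} {y : Fin n} (h : Grown x₀ y₀ A σ X Y) (hxX : x ∈ X)
      (hx : ∀ x' ∈ X, x' ≤ x) (hy : y ∉ Y) (hlast : ∀ y', (x, y') ∈ A → y' < y) :
      Grown x₀ y₀ (insert (x, y) A) (swap (.east x) (.south y) * σ) X (insert y Y)

namespace Grown

variable {x₀ : Fin m} {y₀ : Fin n} {A : Finset (Fin m × Fin n)} {σ : Perm (BorderEdge m n)}
  {X : Finset (Fin m)} {Y : Finset (Fin n)}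

theorem mem_support (h : Grown x₀ y₀ A σ X Y) : ∀ p ∈ A, p.1 ∈ X ∧ p.2 ∈ Y := by
  induction h with
  | root => simp
  | row h hx hy ih =>
    intro p hp
    rcases Finset.mem_insert.1 hp with rfl | hp
    · simp [hy]
    · exact ⟨Finset.mem_insert_of_mem (ih p hp).1, (ih p hp).2⟩
  | column h hxX hx hy hlast ih =>
    intro p hp
    rcases Finset.mem_insert.1 hp with rfl | hp
    · simp [hxX]
    · exact ⟨(ih p hp).1, Finset.mem_insert_of_mem (ih p hp).2⟩

theorem root_mem (h : Grown x₀ y₀ A σ X Y) : (x₀, y₀) ∈ A := by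
  induction h with
  | root => simp
  | row h hx hy ih => exact Finset.mem_insert_of_mem ih
  | column h hxX hx hy hlast ih => exact Finset.mem_insert_of_mem ih

theorem exists_mem_column (h : Grown x₀ y₀ A σ X Y) : ∀ y ∈ Y, ∃ x, (x, y) ∈ A := by
  induction h with
  | root => simp
  | row h hx hy ih =>
    intro v hv
    obtain ⟨u, hu⟩ := ih v hv
    exact ⟨u, Finset.mem_insert_of_mem hu⟩
  | column h hxX hx hy hlast ih =>
    intro v hv
    rcases Finset.mem_insert.1 hv with rfl | hv
    · exact ⟨_, Finset.mem_insert_self _ _⟩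
    · obtain ⟨u, hu⟩ := ih v hv
      exact ⟨u, Finset.mem_insert_of_mem hu⟩

theorem exists_mem_row (h : Grown x₀ y₀ A σ X Y) : ∀ x ∈ X, ∃ y, (x, y) ∈ A := by
  induction h with
  | root => simp
  | row h hx hy ih =>
    intro v hv
    rcases Finset.mem_insert.1 hv with rfl | hv
    · exact ⟨_, Finset.mem_insert_self _ _⟩
    · obtain ⟨u, hu⟩ := ih v hv
      exact ⟨u, Finset.mem_insert_of_mem hu⟩
  | column h hxX hx hy hlast ih =>
    intro v hv
    obtain ⟨u, hu⟩ := ih v hv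
    exact ⟨u, Finset.mem_insert_of_mem hu⟩

/-- The side conditions of each growth step say precisely that the new point is last in its row and
in its column, so each step contributes its transposition. -/
theorem zigzagImage_eq (h : Grown x₀ y₀ A σ X Y) (e : BorderEdge m n) :
    zigzagImage A e = σ e := by
  induction h with
  | root =>
    have := zigzagImage_insert (A := ∅) (x := x₀) (y := y₀) (by simp) (by simp) (by simp) e
    simpa [zigzagImage_empty] using this
  | @row A σ X Y x y h hx hy ih =>
    have hnot : ∀ z w, x ≤ z → (z, w) ∉ A := fun z w hz hmem =>
      absurd (hx z (h.mem_support _ hmem).1) (not_lt.2 hz)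
    rw [zigzagImage_insert (hnot _ _ le_rfl) (fun z hz => hnot _ _ hz.le)
      (fun z _ => hnot _ _ le_rfl), ih, Perm.mul_apply]
  | @column A σ X Y x y h hxX hx hy hlast ih =>
    rw [zigzagImage_insert (fun hmem => hy (h.mem_support _ hmem).2)
      (fun z _ hmem => hy (h.mem_support _ hmem).2)
      (fun z hz hmem => lt_asymm hz (hlast z hmem)), ih, Perm.mul_apply]

/-- The images of the edges of columns and the preimages of those of rows, for the bottom row. -/
theorem isBorderCycle_and_bottom (h : Grown x₀ y₀ A σ X Y) : IsBorderCycle σ X Y ∧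
    ∀ x ∈ X, (∀ x' ∈ X, x' ≤ x) → ∃ y, σ (.east x) = .south y ∧ (x, y) ∈ A ∧
      (∀ v ∈ Y, σ (.south v) = .east x → ∃ w, v ≤ w ∧ (x, w) ∈ A) ∧
      ∀ v, (x, v) ∈ A → v ≤ y ∨ ∃ w, σ (.south w) = .east x ∧ v ≤ w := by
  -- The clauses on the bottom row strengthen the induction. The first of the two on other points
  -- shows that a column step moves column edges rightwards; the second recovers, when a border
  -- cycle is given first, that the points of the bottom row lie left of the new column.
  induction h with
  | root =>
    refine ⟨⟨?_, ?_, ?_, ?_⟩, ?_⟩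
    · rintro (y | x) h <;> simp only [borderEdges_south, borderEdges_east,
        Finset.mem_singleton] at h <;> apply swap_apply_of_ne_of_ne <;> simp [h]
    · have h1 : SameCycle (swap (.east x₀ : BorderEdge m n) (.south y₀)) (.east x₀)
          (.south y₀) := by
        have := sameCycle_swap_mul_self (f := 1) (a := (.east x₀ : BorderEdge m n))
          (b := .south y₀) rfl
        simpa using this
      rintro (y | x) (y' | x') h h' <;> simp only [borderEdges_south, borderEdges_east,
        Finset.mem_singleton] at h h' <;> subst h <;> subst h'
      · exact SameCycle.rfl
      · exact h1.symm
      · exact h1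
      · exact SameCycle.rfl
    · intro y hy y'
      rw [Finset.mem_singleton.1 hy]
      simp
    · intro y hy y'
      rw [Finset.mem_singleton.1 hy]
      simp
    · intro x hx _
      rw [Finset.mem_singleton.1 hx]
      refine ⟨y₀, by simp, by simp, ?_, ?_⟩
      · intro v hv _
        exact ⟨y₀, (Finset.mem_singleton.1 hv).le, by simp⟩
      · intro v hv
        simp only [Finset.mem_singleton, Prod.mk.injEq, true_and] at hv
        exact Or.inl hv.le
  | @row A σ X Y x y h hx hy ih =>
    have hxX : x ∉ X := fun hmem => lt_irrefl _ (hx x hmem)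
    have hfix : σ (.east x) = .east x := ih.1.fixed _ hxX
    have hne : ∀ e, e ≠ .east x → σ e ≠ .east x := fun e he h' =>
      he (σ.injective (h'.trans hfix.symm))
    have hsx : (swap (BorderEdge.east x) (BorderEdge.south y) * σ) (.east x) = .south y := by simp [hfix]
    have hbase : ∀ e, borderEdges (insert x X) Y e →
        SameCycle (swap (BorderEdge.east x) (BorderEdge.south y) * σ) e (.south y) := by
      intro e he
      by_cases hex : e = .east x
      · subst hex
        exact sameCycle_swap_mul_self hfix
      · refine sameCycle_swap_mul hfix (ih.1.sameCycle _ _ ?_ hy)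
        cases e with
        | south v => exact he
        | east u =>
          exact (Finset.mem_insert.1 he).resolve_left fun h' => hex (h' ▸ rfl)
    have hsouth : ∀ v v', (swap (BorderEdge.east x) (BorderEdge.south y) * σ) (.south v) = .south v' →
        σ (.south v) = .south v' := by
      intro v v' hv
      rw [Perm.mul_apply] at hv
      by_cases h' : σ (.south v) = .south y
      · simp [h'] at hv
      · rwa [swap_apply_of_ne_of_ne (hne _ (by simp)) h'] at hv
    refine ⟨⟨?_, fun e e' he he' => (hbase e he).trans (hbase e' he').symm, ?_, ?_⟩, ?_⟩
    · intro e he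
      have he1 : ¬ borderEdges X Y e := by
        cases e with
        | south v => exact he
        | east u => exact fun h' => he (Finset.mem_insert_of_mem h')
      rw [Perm.mul_apply, ih.1.fixed e he1]
      apply swap_apply_of_ne_of_ne
      · rintro rfl
        exact he (Finset.mem_insert_self _ _)
      · rintro rfl
        exact he hy
    · exact fun v hv v' hv' => ih.1.south_lt v hv v' (hsouth v v' hv')
    · intro u hu u' hu'
      rcases Finset.mem_insert.1 hu with rfl | huX
      · rw [hsx] at hu'
        cases hu'
      · rw [Perm.mul_apply] at hu'
        -- A row that used to go to column `y` now goes to the new row `x`, which is below all old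
        -- rows.
        by_cases h' : σ (.east u) = .south y
        · rw [h', swap_apply_right, BorderEdge.east.injEq] at hu'
          exact hu' ▸ hx u huX
        · rw [swap_apply_of_ne_of_ne (hne _ ?_) h'] at hu'
          · exact ih.1.east_lt u huX u' hu'
          · simp only [ne_eq, BorderEdge.east.injEq]
            rintro rfl
            exact hxX huX
    · intro u hu hmax
      obtain rfl : u = x := by
        rcases Finset.mem_insert.1 hu with h' | h'
        · exact h'
        · exact absurd (hx u h') (not_lt.2 (hmax x (Finset.mem_insert_self _ _)))
      refine ⟨y, hsx, Finset.mem_insert_self _ _, ?_, ?_⟩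
      · intro v hv hv'
        refine ⟨y, ?_, Finset.mem_insert_self _ _⟩
        rw [Perm.mul_apply] at hv'
        by_cases h' : σ (.south v) = .south y
        · exact (ih.1.south_lt v hv y h').le
        · rw [swap_apply_of_ne_of_ne (hne _ (by simp)) h'] at hv'
          exact absurd hv' (hne _ (by simp))
      · intro v hv
        rcases Finset.mem_insert.1 hv with h' | h'
        · exact Or.inl (Prod.ext_iff.1 h').2.le
        · exact absurd (h.mem_support _ h').1 hxX
  | @column A σ X Y x y h hxX hx hy hlast ih =>
    have hfix : σ (.south y) = .south y := ih.1.fixed _ hy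
    have hne : ∀ e, e ≠ .south y → σ e ≠ .south y := fun e he h' =>
      he (σ.injective (h'.trans hfix.symm))
    -- The fixed point to be inserted is now the column edge, which the insertion lemmas expect as
    -- first entry of the transposition.
    rw [swap_comm]
    have hsy : (swap (BorderEdge.south y) (BorderEdge.east x) * σ) (.south y) = .east x := by simp [hfix]
    have hbase : ∀ e, borderEdges X (insert y Y) e →
        SameCycle (swap (BorderEdge.south y) (BorderEdge.east x) * σ) e (.east x) := by
      intro e he
      by_cases hex : e = .south y
      · subst hex
        exact sameCycle_swap_mul_self hfix
      · refine sameCycle_swap_mul hfix (ih.1.sameCycle _ _ ?_ hxX)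
        cases e with
        | east v => exact he
        | south u =>
          exact (Finset.mem_insert.1 he).resolve_left fun h' => hex (h' ▸ rfl)
    obtain ⟨y₁, hy₁, hy₁A, hpre, -⟩ := ih.2 x hxX hx
    have hsx : (swap (BorderEdge.south y) (BorderEdge.east x) * σ) (.east x) = .south y₁ := by
      rw [Perm.mul_apply, hy₁, swap_apply_of_ne_of_ne _ (by simp)]
      simpa using (hlast y₁ hy₁A).ne
    refine ⟨⟨?_, fun e e' he he' => (hbase e he).trans (hbase e' he').symm, ?_, ?_⟩, ?_⟩
    · intro e he
      have he1 : ¬ borderEdges X Y e := by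
        cases e with
        | east v => exact he
        | south u => exact fun h' => he (Finset.mem_insert_of_mem h')
      rw [Perm.mul_apply, ih.1.fixed e he1]
      apply swap_apply_of_ne_of_ne
      · rintro rfl
        exact he (Finset.mem_insert_self _ _)
      · rintro rfl
        exact he hxX
    · intro v hv v' hv'
      rcases Finset.mem_insert.1 hv with rfl | hvY
      · rw [hsy] at hv'
        cases hv'
      · rw [Perm.mul_apply] at hv'
        -- A column `v` that used to go to row `x` now goes to `y`. The invariant provides a point
        -- of row `x` in a column at or to the right of `v`, and this point lies left of `y`.
        by_cases h' : σ (.south v) = .east x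
        · rw [h', swap_apply_right, BorderEdge.south.injEq] at hv'
          obtain ⟨w, hw, hwA⟩ := hpre v hvY h'
          exact hv' ▸ hw.trans_lt (hlast w hwA)
        · rw [swap_apply_of_ne_of_ne (hne _ ?_) h'] at hv'
          · exact ih.1.south_lt v hvY v' hv'
          · simp only [ne_eq, BorderEdge.south.injEq]
            rintro rfl
            exact hy hvY
    · intro u hu u' hu'
      rw [Perm.mul_apply] at hu'
      by_cases h' : σ (.east u) = .east x
      · rw [h', swap_apply_right] at hu'
        cases hu'
      · rw [swap_apply_of_ne_of_ne (hne _ (by simp)) h'] at hu'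
        exact ih.1.east_lt u hu u' hu'
    · intro u hu hmax
      obtain rfl : u = x := le_antisymm (hx u hu) (hmax x hxX)
      refine ⟨y₁, hsx, Finset.mem_insert_of_mem hy₁A, ?_, ?_⟩
      · intro v hv hv'
        have : (.south v : BorderEdge m n) = .south y :=
          (swap (BorderEdge.south y) (BorderEdge.east u) * σ).injective (hv'.trans hsy.symm)
        rw [BorderEdge.south.injEq] at this
        exact ⟨y, this.le, Finset.mem_insert_self _ _⟩
      · intro v hv
        refine Or.inr ⟨y, hsy, ?_⟩
        rcases Finset.mem_insert.1 hv with h' | h'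
        · exact (Prod.ext_iff.1 h').2.le
        · exact (hlast v h').le

theorem isBorderCycle (h : Grown x₀ y₀ A σ X Y) : IsBorderCycle σ X Y :=
  h.isBorderCycle_and_bottom.1

end Grown

end Core

/-! ### Recovering a grown point set from its border cycle. -/

section Core

variable {m n : ℕ} {σ : Perm (BorderEdge m n)} {X : Finset (Fin m)} {Y : Finset (Fin n)}

namespace IsBorderCycle

theorem mem_of_apply_south (h : IsBorderCycle σ X Y) {e : BorderEdge m n} {y : Fin n}
    (he : σ e = .south y) (hne : e ≠ .south y) : y ∈ Y := by
  by_contra hy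
  exact hne (σ.injective (he.trans (h.fixed (.south y) hy).symm))

theorem mem_of_apply_east (h : IsBorderCycle σ X Y) {e : BorderEdge m n} {x : Fin m}
    (he : σ e = .east x) (hne : e ≠ .east x) : x ∈ X := by
  by_contra hx
  exact hne (σ.injective (he.trans (h.fixed (.east x) hx).symm))

theorem mem_of_south_apply (h : IsBorderCycle σ X Y) {e : BorderEdge m n} {y : Fin n}
    (he : σ (.south y) = e) (hne : e ≠ .south y) : y ∈ Y := by
  by_contra hy
  exact hne (he.symm.trans (h.fixed (.south y) hy))

theorem mem_of_east_apply (h : IsBorderCycle σ X Y) {e : BorderEdge m n} {x : Fin m}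
    (he : σ (.east x) = e) (hne : e ≠ .east x) : x ∈ X := by
  by_contra hx
  exact hne (he.symm.trans (h.fixed (.east x) hx))

/-- A row edge can only move to a strictly lower row, and there is none below the bottom one. -/
theorem exists_apply_bottom (h : IsBorderCycle σ X Y) {x : Fin m} (hx : x ∈ X)
    (hmax : ∀ x' ∈ X, x' ≤ x) : ∃ y ∈ Y, σ (.east x) = .south y := by
  cases he : σ (.east x) with
  | south y => exact ⟨y, h.mem_of_apply_south he (by simp), rfl⟩
  | east x' =>
    have hlt := h.east_lt x hx x' he
    exact absurd (hmax x' (h.mem_of_apply_east he (by simpa using hlt.ne))) (not_le.2 hlt)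

/-- This undoes a row step: the preimage of row `x` is redirected to column `y`, and `hlt` makes
this a rightward move when the preimage is a column. -/
theorem erase_row (h : IsBorderCycle σ X Y) {x : Fin m} {y : Fin n}
    (hσ : σ (.east x) = .south y) (hlt : ∀ v, σ (.south v) = .east x → v < y) :
    IsBorderCycle (swap (.east x) (.south y) * σ) (X.erase x) Y := by
  have hyY : y ∈ Y := h.mem_of_apply_south hσ (by simp)
  have hxX : x ∈ X := h.mem_of_east_apply hσ (by simp)
  have hfix : (swap (BorderEdge.east x) (BorderEdge.south y) * σ) (.east x) = .east x := by
    simp [hσ]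
  have hsub : ∀ e, borderEdges (X.erase x) Y e → borderEdges X Y e ∧ e ≠ .east x := by
    rintro (v | u) he
    · exact ⟨he, by simp⟩
    · exact ⟨(Finset.mem_erase.1 he).2, by simpa using (Finset.mem_erase.1 he).1⟩
  refine ⟨?_, ?_, ?_, ?_⟩
  · intro e he
    by_cases hex : e = .east x
    · rw [hex, hfix]
    · have he' : ¬ borderEdges X Y e := by
        cases e with
        | south v => exact he
        | east u =>
          exact fun h' => he (Finset.mem_erase.2 ⟨fun h'' => hex (h'' ▸ rfl), h'⟩)
      rw [Perm.mul_apply, h.fixed e he', swap_apply_of_ne_of_ne hex]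
      rintro rfl
      exact he' hyY
  · intro e e' he he'
    refine SameCycle.of_swap_mul (b := .south y) hfix (hsub e he).2 (hsub e' he').2 ?_
    rw [swap_mul_self_mul]
    exact h.sameCycle e e' (hsub e he).1 (hsub e' he').1
  · intro v hv v' hv'
    rw [Perm.mul_apply] at hv'
    by_cases h1 : σ (.south v) = .east x
    · rw [h1, swap_apply_left, BorderEdge.south.injEq] at hv'
      exact hv' ▸ hlt v h1
    · by_cases h2 : σ (.south v) = .south y
      · rw [h2, swap_apply_right] at hv'
        cases hv'
      · rw [swap_apply_of_ne_of_ne h1 h2] at hv'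
        exact h.south_lt v hv v' hv'
  · intro u hu u' hu'
    rw [Perm.mul_apply] at hu'
    by_cases h1 : σ (.east u) = .east x
    · rw [h1, swap_apply_left] at hu'
      cases hu'
    · by_cases h2 : σ (.east u) = .south y
      · have := σ.injective (h2.trans hσ.symm)
        rw [BorderEdge.east.injEq] at this
        exact absurd this (Finset.mem_erase.1 hu).1
      · rw [swap_apply_of_ne_of_ne h1 h2] at hu'
        exact h.east_lt u (Finset.mem_erase.1 hu).2 u' hu'

/-- This undoes a column step: the preimage of column `y` is redirected to row `x`. From another row
this is a downward move since `x` is the bottom row, and `hne` prevents row `x` from becoming fixed.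
-/
theorem erase_column (h : IsBorderCycle σ X Y) {x : Fin m} {y : Fin n}
    (hmax : ∀ x' ∈ X, x' ≤ x) (hσ : σ (.south y) = .east x) (hne : σ (.east x) ≠ .south y) :
    IsBorderCycle (swap (.east x) (.south y) * σ) X (Y.erase y) := by
  rw [swap_comm]
  have hyY : y ∈ Y := h.mem_of_south_apply hσ (by simp)
  have hxX : x ∈ X := h.mem_of_apply_east hσ (by simp)
  have hfix : (swap (BorderEdge.south y) (BorderEdge.east x) * σ) (.south y) = .south y := by
    simp [hσ]
  have hsub : ∀ e, borderEdges X (Y.erase y) e → borderEdges X Y e ∧ e ≠ .south y := by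
    rintro (v | u) he
    · exact ⟨(Finset.mem_erase.1 he).2, by simpa using (Finset.mem_erase.1 he).1⟩
    · exact ⟨he, by simp⟩
  refine ⟨?_, ?_, ?_, ?_⟩
  · intro e he
    by_cases hex : e = .south y
    · rw [hex, hfix]
    · have he' : ¬ borderEdges X Y e := by
        cases e with
        | east v => exact he
        | south u =>
          exact fun h' => he (Finset.mem_erase.2 ⟨fun h'' => hex (h'' ▸ rfl), h'⟩)
      rw [Perm.mul_apply, h.fixed e he', swap_apply_of_ne_of_ne hex]
      rintro rfl
      exact he' hxX
  · intro e e' he he'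
    refine SameCycle.of_swap_mul (b := .east x) hfix (hsub e he).2 (hsub e' he').2 ?_
    rw [swap_mul_self_mul]
    exact h.sameCycle e e' (hsub e he).1 (hsub e' he').1
  · intro v hv v' hv'
    rw [Perm.mul_apply] at hv'
    by_cases h1 : σ (.south v) = .south y
    · rw [h1, swap_apply_left] at hv'
      cases hv'
    · by_cases h2 : σ (.south v) = .east x
      · have := σ.injective (h2.trans hσ.symm)
        rw [BorderEdge.south.injEq] at this
        exact absurd this (Finset.mem_erase.1 hv).1
      · rw [swap_apply_of_ne_of_ne h1 h2] at hv'
        exact h.south_lt v (Finset.mem_erase.1 hv).2 v' hv'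
  · intro u hu u' hu'
    rw [Perm.mul_apply] at hu'
    by_cases h1 : σ (.east u) = .south y
    · rw [h1, swap_apply_left, BorderEdge.east.injEq] at hu'
      subst hu'
      refine lt_of_le_of_ne (hmax u hu) ?_
      rintro rfl
      exact hne h1
    · by_cases h2 : σ (.east u) = .east x
      · rw [h2, swap_apply_right] at hu'
        cases hu'
      · rw [swap_apply_of_ne_of_ne h1 h2] at hu'
        exact h.east_lt u hu u' hu'

/-- Every border cycle comes from a grown point set. -/
theorem exists_grown {x₀ : Fin m} {y₀ : Fin n} (k : ℕ) :
    ∀ {σ : Perm (BorderEdge m n)} {X : Finset (Fin m)} {Y : Finset (Fin n)},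
      IsBorderCycle σ X Y → X.card + Y.card = k → x₀ ∈ X → y₀ ∈ Y → (∀ x ∈ X, x₀ ≤ x) →
      (∀ y ∈ Y, y₀ ≤ y) → ∃ A, Grown x₀ y₀ A σ X Y := by
  induction k with
  | zero =>
    intro σ X Y _ hk hx₀
    exact absurd (Finset.card_pos.2 ⟨x₀, hx₀⟩) (by omega)
  | succ k ih =>
    intro σ X Y h hk hx₀ hy₀ hxmin hymin
    have hxX := X.max'_mem ⟨x₀, hx₀⟩
    have hmax : ∀ x' ∈ X, x' ≤ X.max' ⟨x₀, hx₀⟩ := fun x' hx' => X.le_max' x' hx'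
    generalize X.max' ⟨x₀, hx₀⟩ = x at hxX hmax
    obtain ⟨y₁, hy₁Y, hy₁⟩ := h.exists_apply_bottom hxX hmax
    by_cases hcol : ∃ y, σ (.south y) = .east x ∧ y₁ < y
    · obtain ⟨y, hy, hlt⟩ := hcol
      have hyY : y ∈ Y := h.mem_of_south_apply hy (by simp)
      have h' := h.erase_column hmax hy (by rw [hy₁]; simpa using hlt.ne)
      obtain ⟨A, hA⟩ := ih h' (by rw [Finset.card_erase_of_mem hyY]; have := Finset.card_pos.2 ⟨y, hyY⟩; omega) hx₀
        (Finset.mem_erase.2 ⟨((hymin y₁ hy₁Y).trans_lt hlt).ne, hy₀⟩) hxmin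
        fun v hv => hymin v (Finset.mem_erase.1 hv).2
      have := Grown.column hA hxX hmax (Finset.notMem_erase y Y) ?_
      · rw [swap_mul_self_mul, Finset.insert_erase hyY] at this
        exact ⟨_, this⟩
      · intro v hv
        -- The points left in row `x` are bounded by `y₁ < y` or by a column `w` that is now sent to
        -- row `x`. Before the erasure `w` was sent to column `y`, so `w < y`.
        obtain ⟨y₂, hy₂, -, -, hbot⟩ := hA.isBorderCycle_and_bottom.2 x hxX hmax
        rw [Perm.mul_apply, hy₁, swap_apply_of_ne_of_ne (by simp) (by simpa using hlt.ne),
          BorderEdge.south.injEq] at hy₂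
        subst hy₂
        rcases hbot v hv with hv | ⟨w, hw, hvw⟩
        · exact hv.trans_lt hlt
        · refine hvw.trans_lt (h.south_lt w ?_ y ?_)
          · exact (Finset.mem_erase.1 (h'.mem_of_south_apply hw (by simp))).2
          · have := congrArg (swap (BorderEdge.east x) (BorderEdge.south y)) hw
            rw [Perm.mul_apply, swap_apply_self, swap_apply_left] at this
            exact this
    · push Not at hcol
      by_cases hloop : σ (.south y₁) = .east x
      · have hall : ∀ e, borderEdges X Y e → e = .east x ∨ e = .south y₁ := by
          intro e he
          -- The two edges form a cycle of `σ`, so membership in this pair is an invariant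
          -- predicate; there is only one cycle, hence no further edge.
          have := (h.sameCycle (.east x) e hxX he).map (g := (1 : Perm Prop))
            (π := fun e => e = .east x ∨ e = .south y₁) fun e => by
              rw [sameCycle_one]
              apply propext
              constructor
              · rintro (rfl | rfl)
                · exact Or.inr hy₁
                · exact Or.inl hloop
              · rintro (h' | h')
                · exact Or.inr (σ.injective (h'.trans hloop.symm))
                · exact Or.inl (σ.injective (h'.trans hy₁.symm))
          rw [sameCycle_one] at this
          exact this.mp (Or.inl rfl)
        have hX : X = {x} := Finset.eq_singleton_iff_unique_mem.2
          ⟨hxX, fun u hu => by simpa using hall (.east u) hu⟩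
        have hY : Y = {y₁} := Finset.eq_singleton_iff_unique_mem.2
          ⟨hy₁Y, fun u hu => by simpa using hall (.south u) hu⟩
        subst hX hY
        rw [Finset.mem_singleton] at hx₀ hy₀
        subst hx₀ hy₀
        have : σ = swap (.east x₀) (.south y₀) := by
          ext e
          by_cases h1 : e = .east x₀
          · rw [h1, hy₁, swap_apply_left]
          · by_cases h2 : e = .south y₀
            · rw [h2, hloop, swap_apply_right]
            · rw [swap_apply_of_ne_of_ne h1 h2, h.fixed e fun he => (hall e he).elim h1 h2]
        rw [this]
        exact ⟨_, Grown.root⟩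
      · have hlt : ∀ v, σ (.south v) = .east x → v < y₁ := fun v hv =>
          lt_of_le_of_ne (hcol v hv) fun h' => hloop (h' ▸ hv)
        -- If `x` were the only row, the rightmost column could only be sent to it. But every column
        -- sent to `x` lies strictly left of `y₁`, which is itself a column.
        have hxne : x₀ ≠ x := by
          rintro rfl
          have hle := Y.le_max' y₁ hy₁Y
          have hMY := Y.max'_mem ⟨y₀, hy₀⟩
          cases hM : σ (.south (Y.max' ⟨y₀, hy₀⟩)) with
          | south v =>
            have hv := h.south_lt _ hMY v hM
            exact absurd (Y.le_max' v (h.mem_of_apply_south hM (by simpa using hv.ne)))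
              (not_le.2 hv)
          | east u =>
            obtain rfl : u = x₀ := by
              have hu := h.mem_of_apply_east hM (by simp)
              exact le_antisymm (hmax u hu) (hxmin u hu)
            exact absurd (hlt _ hM) (not_lt.2 hle)
        obtain ⟨A, hA⟩ := ih (h.erase_row hy₁ hlt)
          (by rw [Finset.card_erase_of_mem hxX]; have := Finset.card_pos.2 ⟨x, hxX⟩; omega)
          (Finset.mem_erase.2 ⟨hxne, hx₀⟩) hy₀ (fun v hv => hxmin v (Finset.mem_erase.1 hv).2)
          hymin
        have := Grown.row hA (fun x' hx' => lt_of_le_of_ne (hmax x' (Finset.mem_erase.1 hx').2)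
          (Finset.mem_erase.1 hx').1) hy₁Y
        rw [swap_mul_self_mul, Finset.insert_erase hxX] at this
        exact ⟨_, this⟩

end IsBorderCycle

namespace Grown

variable {x₀ : Fin m} {y₀ : Fin n} {A A' : Finset (Fin m × Fin n)}

theorem root_mem_support (h : Grown x₀ y₀ A σ X Y) : x₀ ∈ X ∧ y₀ ∈ Y :=
  h.mem_support _ h.root_mem

/-- The permutation determines the last step in the construction of a grown point set. -/
theorem last_step (h : Grown x₀ y₀ A σ X Y) :
    (X = {x₀} ∧ Y = {y₀} ∧ A = {(x₀, y₀)}) ∨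
    (∃ x y B, x ∈ X ∧ (∀ x' ∈ X, x' ≤ x) ∧ σ (.east x) = .south y ∧ A = insert (x, y) B ∧
      X ≠ {x₀} ∧ (∀ v, σ (.south v) = .east x → v < y) ∧
      Grown x₀ y₀ B (swap (.east x) (.south y) * σ) (X.erase x) Y) ∨
    (∃ x y B, x ∈ X ∧ (∀ x' ∈ X, x' ≤ x) ∧ σ (.south y) = .east x ∧ A = insert (x, y) B ∧
      y ∈ Y ∧ Y ≠ {y₀} ∧ (∀ v, σ (.east x) = .south v → v < y) ∧
      Grown x₀ y₀ B (swap (.east x) (.south y) * σ) X (Y.erase y)) := by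
  cases h with
  | root => exact Or.inl ⟨rfl, rfl, rfl⟩
  | @row B τ X _ x y h hx hy =>
    refine Or.inr (Or.inl ⟨x, y, B, ?_⟩)
    have hxX : x ∉ X := fun h' => lt_irrefl _ (hx x h')
    have hfix : τ (.east x) = .east x := h.isBorderCycle.fixed _ hxX
    refine ⟨Finset.mem_insert_self _ _, ?_, by simp [hfix], rfl, ?_, ?_, ?_⟩
    · intro x' hx'
      rcases Finset.mem_insert.1 hx' with rfl | hx'
      · exact le_rfl
      · exact (hx x' hx').le
    · intro heq
      have h1 : x = x₀ := Finset.mem_singleton.1 (heq.subset (Finset.mem_insert_self x X))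
      exact hxX (h1 ▸ h.root_mem_support.1)
    · intro v hv
      rw [Perm.mul_apply, swap_apply_eq_iff, swap_apply_left] at hv
      have hvY : v ∈ Y := by
        by_contra hvY
        rw [h.isBorderCycle.fixed (.south v) hvY, BorderEdge.south.injEq] at hv
        exact hvY (hv ▸ hy)
      exact h.isBorderCycle.south_lt v hvY y hv
    · rwa [swap_mul_self_mul, Finset.erase_insert hxX]
  | @column B τ _ Y x y h hxX hx hy hlast =>
    refine Or.inr (Or.inr ⟨x, y, B, hxX, hx, ?_, rfl, Finset.mem_insert_self _ _, ?_, ?_, ?_⟩)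
    · have hfix : τ (.south y) = .south y := h.isBorderCycle.fixed _ hy
      simp [hfix]
    · intro heq
      have h1 : y = y₀ := Finset.mem_singleton.1 (heq.subset (Finset.mem_insert_self y Y))
      exact hy (h1 ▸ h.root_mem_support.2)
    · intro v hv
      obtain ⟨y₁, hy₁, hy₁A, -⟩ := h.isBorderCycle_and_bottom.2 x hxX hx
      have hlt := hlast y₁ hy₁A
      rw [Perm.mul_apply, hy₁, swap_apply_of_ne_of_ne (by simp) (by simpa using hlt.ne),
        BorderEdge.south.injEq] at hv
      exact hv ▸ hlt
    · rwa [swap_mul_self_mul, Finset.erase_insert hy]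

/-- In the bottom row `x`, compare the column that `x` is sent to with a column sent to `x`. A final
row step and a final column step force opposite strict inequalities, so two constructions with the
same permutation end with the same step. -/
theorem eq_of_grown (k : ℕ) : ∀ {σ : Perm (BorderEdge m n)} {X : Finset (Fin m)}
    {Y : Finset (Fin n)} {A A' : Finset (Fin m × Fin n)}, X.card + Y.card = k →
      Grown x₀ y₀ A σ X Y → Grown x₀ y₀ A' σ X Y → A = A' := by
  induction k with
  | zero =>
    intro σ X Y A A' hk h
    exact absurd (Finset.card_pos.2 ⟨x₀, h.root_mem_support.1⟩) (by omega)
  | succ k ih =>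
    intro σ X Y A A' hk h h'
    rcases h.last_step with ⟨hX, hY, rfl⟩ | ⟨x, y, B, hxX, hx, hσ, rfl, hX, hlt, hB⟩ |
      ⟨x, y, B, hxX, hx, hσ, rfl, hyY, hY, hlt, hB⟩ <;>
    rcases h'.last_step with ⟨hX', hY', rfl⟩ | ⟨x', y', B', hxX', hx', hσ', rfl, hX', hlt', hB'⟩ |
      ⟨x', y', B', hxX', hx', hσ', rfl, hyY', hY', hlt', hB'⟩
    · rfl
    · exact absurd hX hX'
    · exact absurd hY hY'
    · exact absurd hX' hX
    · obtain rfl : x = x' := le_antisymm (hx' x hxX) (hx x' hxX')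
      obtain rfl : y = y' := by simpa using hσ.symm.trans hσ'
      rw [ih (by rw [Finset.card_erase_of_mem hxX]; have := Finset.card_pos.2 ⟨x, hxX⟩; omega)
        hB hB']
    · obtain rfl : x = x' := le_antisymm (hx' x hxX) (hx x' hxX')
      exact absurd (hlt y' hσ') (lt_asymm (hlt' y hσ))
    · exact absurd hY' hY
    · obtain rfl : x = x' := le_antisymm (hx' x hxX) (hx x' hxX')
      exact absurd (hlt y' hσ') (lt_asymm (hlt' y hσ))
    · obtain rfl : x = x' := le_antisymm (hx' x hxX) (hx x' hxX')
      obtain rfl : y = y' := by simpa using σ.injective (hσ.trans hσ'.symm)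
      rw [ih (by rw [Finset.card_erase_of_mem hyY]; have := Finset.card_pos.2 ⟨y, hyY⟩; omega)
        hB hB']

end Grown

/-! ### Non-ambiguous point sets are grown. -/

/-- The characterization of the geometric presentations of non-ambiguous trees with rows `X`,
columns `Y` and root `(x₀, y₀)`. -/
structure IsNonAmbiguous (x₀ : Fin m) (y₀ : Fin n) (A : Finset (Fin m × Fin n))
    (X : Finset (Fin m)) (Y : Finset (Fin n)) : Prop where
  root_mem : (x₀, y₀) ∈ A
  root_le : ∀ p ∈ A, x₀ ≤ p.1 ∧ y₀ ≤ p.2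
  mem_support : ∀ p ∈ A, p.1 ∈ X ∧ p.2 ∈ Y
  exists_row : ∀ x ∈ X, ∃ y, (x, y) ∈ A
  exists_column : ∀ y ∈ Y, ∃ x, (x, y) ∈ A
  exists_parent : ∀ p ∈ A, p ≠ (x₀, y₀) →
    (∃ x, x < p.1 ∧ (x, p.2) ∈ A) ∨ ∃ y, y < p.2 ∧ (p.1, y) ∈ A
  parent_unique : ∀ p ∈ A, ∀ x y, x < p.1 → (x, p.2) ∈ A → y < p.2 → (p.1, y) ∉ A

/-- The rightmost point of the bottom row has nothing below it or to its right, so no other point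
needs it as a parent. Since it cannot have points both above and to its left, removing it empties
exactly its row or exactly its column, unless it is the root. -/
theorem IsNonAmbiguous.exists_grown {x₀ : Fin m} {y₀ : Fin n} (k : ℕ) :
    ∀ {A : Finset (Fin m × Fin n)} {X : Finset (Fin m)} {Y : Finset (Fin n)},
      IsNonAmbiguous x₀ y₀ A X Y → A.card = k → ∃ σ, Grown x₀ y₀ A σ X Y := by
  induction k with
  | zero =>
    intro A X Y h hk
    exact absurd (Finset.card_pos.2 ⟨_, h.root_mem⟩) (by omega)
  | succ k ih =>
    intro A X Y h hk
    have hx₀ := (h.mem_support _ h.root_mem).1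
    have hxX := X.max'_mem ⟨x₀, hx₀⟩
    have hmax : ∀ x' ∈ X, x' ≤ X.max' ⟨x₀, hx₀⟩ := fun x' hx' => X.le_max' x' hx'
    generalize X.max' ⟨x₀, hx₀⟩ = x at hxX hmax
    obtain ⟨y, hyA, hymax⟩ : ∃ y, (x, y) ∈ A ∧ ∀ z, (x, z) ∈ A → z ≤ y := by
      obtain ⟨z, hz⟩ := h.exists_row x hxX
      have hne : (Finset.univ.filter fun z => (x, z) ∈ A).Nonempty := ⟨z, by simp [hz]⟩
      refine ⟨_, (Finset.mem_filter.1 (Finset.max'_mem _ hne)).2, fun w hw => ?_⟩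
      exact Finset.le_max' _ _ (by simp [hw])
    by_cases hroot : (x, y) = (x₀, y₀)
    · simp only [Prod.mk.injEq] at hroot
      obtain ⟨rfl, rfl⟩ := hroot
      have hA : A = {(x, y)} := Finset.eq_singleton_iff_unique_mem.2 ⟨hyA, fun p hp => by
        obtain ⟨u, v⟩ := p
        obtain rfl : u = x := le_antisymm (hmax _ (h.mem_support _ hp).1) (h.root_le _ hp).1
        obtain rfl : v = y := le_antisymm (hymax _ hp) (h.root_le _ hp).2
        rfl⟩
      subst hA
      have hX : X = {x} := Finset.eq_singleton_iff_unique_mem.2 ⟨hxX, fun u hu => by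
        obtain ⟨v, hv⟩ := h.exists_row u hu
        exact (Prod.ext_iff.1 (Finset.mem_singleton.1 hv)).1⟩
      have hY : Y = {y} := Finset.eq_singleton_iff_unique_mem.2
        ⟨(h.mem_support _ hyA).2, fun u hu => by
          obtain ⟨v, hv⟩ := h.exists_column u hu
          exact (Prod.ext_iff.1 (Finset.mem_singleton.1 hv)).2⟩
      subst hX hY
      exact ⟨_, Grown.root⟩
    · have hyY := (h.mem_support _ hyA).2
      have hcard : (A.erase (x, y)).card = k := by
        rw [Finset.card_erase_of_mem hyA]
        omega
      have hparent : ∀ p ∈ A.erase (x, y), p ≠ (x₀, y₀) →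
          (∃ u, u < p.1 ∧ (u, p.2) ∈ A.erase (x, y)) ∨
            ∃ v, v < p.2 ∧ (p.1, v) ∈ A.erase (x, y) := by
        intro p hp hp0
        have hpA := (Finset.mem_erase.1 hp).2
        rcases h.exists_parent p hpA hp0 with ⟨u, hu, huA⟩ | ⟨v, hv, hvA⟩
        · refine Or.inl ⟨u, hu, Finset.mem_erase.2 ⟨fun h' => ?_, huA⟩⟩
          have hux : u = x := (Prod.ext_iff.1 h').1
          rw [hux] at hu
          exact absurd hu (not_lt.2 (hmax _ (h.mem_support _ hpA).1))
        · refine Or.inr ⟨v, hv, Finset.mem_erase.2 ⟨fun h' => ?_, hvA⟩⟩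
          obtain ⟨h1, h2⟩ := Prod.ext_iff.1 h'
          simp only at h1 h2
          rw [h2] at hv
          refine absurd hv (not_lt.2 (hymax _ ?_))
          rw [← h1]
          exact hpA
      have hunique : ∀ p ∈ A.erase (x, y), ∀ u v, u < p.1 → (u, p.2) ∈ A.erase (x, y) →
          v < p.2 → (p.1, v) ∉ A.erase (x, y) := fun p hp u v hu huA hv hvA =>
        h.parent_unique p (Finset.mem_erase.1 hp).2 u v hu (Finset.mem_erase.1 huA).2 hv
          (Finset.mem_erase.1 hvA).2
      have hrootA : (x₀, y₀) ∈ A.erase (x, y) := Finset.mem_erase.2 ⟨Ne.symm hroot, h.root_mem⟩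
      rcases h.exists_parent _ hyA hroot with ⟨u, hu, huA⟩ | ⟨v, hv, hvA⟩
      · have hleft : ∀ z, (x, z) ∈ A → z = y := fun z hz => by
          rcases (hymax z hz).lt_or_eq with h' | h'
          · exact absurd hz (h.parent_unique _ hyA u z hu huA h')
          · exact h'
        have hS : IsNonAmbiguous x₀ y₀ (A.erase (x, y)) (X.erase x) Y := by
          refine ⟨hrootA, fun p hp => h.root_le p (Finset.mem_erase.1 hp).2, ?_, ?_, ?_, hparent,
            hunique⟩
          · rintro ⟨a, b⟩ hp
            obtain ⟨hp1, hp2⟩ := Finset.mem_erase.1 hp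
            refine ⟨Finset.mem_erase.2 ⟨?_, (h.mem_support _ hp2).1⟩, (h.mem_support _ hp2).2⟩
            rintro rfl
            exact hp1 (by rw [hleft b hp2])
          · intro a ha
            obtain ⟨ha1, ha2⟩ := Finset.mem_erase.1 ha
            obtain ⟨b, hb⟩ := h.exists_row a ha2
            exact ⟨b, Finset.mem_erase.2 ⟨fun h' => ha1 (Prod.ext_iff.1 h').1, hb⟩⟩
          · intro b hb
            by_cases hby : b = y
            · subst hby
              exact ⟨u, Finset.mem_erase.2 ⟨fun h' => hu.ne (Prod.ext_iff.1 h').1, huA⟩⟩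
            · obtain ⟨a, ha⟩ := h.exists_column b hb
              exact ⟨a, Finset.mem_erase.2 ⟨fun h' => hby (Prod.ext_iff.1 h').2, ha⟩⟩
        obtain ⟨σ, hσ⟩ := ih hS hcard
        have := Grown.row hσ (x := x) (fun a ha => lt_of_le_of_ne
          (hmax a (Finset.mem_erase.1 ha).2) (Finset.mem_erase.1 ha).1) hyY
        rw [Finset.insert_erase hyA, Finset.insert_erase hxX] at this
        exact ⟨_, this⟩
      · have hup : ∀ z, (z, y) ∈ A → z = x := fun z hz => by
          rcases (hmax z (h.mem_support _ hz).1).lt_or_eq with h' | h'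
          · exact absurd hvA (h.parent_unique _ hyA z v h' hz hv)
          · exact h'
        have hS : IsNonAmbiguous x₀ y₀ (A.erase (x, y)) X (Y.erase y) := by
          refine ⟨hrootA, fun p hp => h.root_le p (Finset.mem_erase.1 hp).2, ?_, ?_, ?_, hparent,
            hunique⟩
          · rintro ⟨a, b⟩ hp
            obtain ⟨hp1, hp2⟩ := Finset.mem_erase.1 hp
            refine ⟨(h.mem_support _ hp2).1, Finset.mem_erase.2 ⟨?_, (h.mem_support _ hp2).2⟩⟩
            rintro rfl
            exact hp1 (by rw [hup a hp2])
          · intro a ha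
            by_cases hax : a = x
            · subst hax
              exact ⟨v, Finset.mem_erase.2 ⟨fun h' => hv.ne (Prod.ext_iff.1 h').2, hvA⟩⟩
            · obtain ⟨b, hb⟩ := h.exists_row a ha
              exact ⟨b, Finset.mem_erase.2 ⟨fun h' => hax (Prod.ext_iff.1 h').1, hb⟩⟩
          · intro b hb
            obtain ⟨hb1, hb2⟩ := Finset.mem_erase.1 hb
            obtain ⟨a, ha⟩ := h.exists_column b hb2
            exact ⟨a, Finset.mem_erase.2 ⟨fun h' => hb1 (Prod.ext_iff.1 h').2, ha⟩⟩
        obtain ⟨σ, hσ⟩ := ih hS hcard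
        have := Grown.column hσ hxX hmax (Finset.notMem_erase y Y) fun z hz => by
          obtain ⟨h1, h2⟩ := Finset.mem_erase.1 hz
          exact lt_of_le_of_ne (hymax z h2) fun h' => h1 (h' ▸ rfl)
        rw [Finset.insert_erase hyA, Finset.insert_erase hyY] at this
        exact ⟨_, this⟩

end Core

/-! ### Labelled trees and their point sets. -/

section Trees

theorem mem_sideLabels_node {c d : Side} {a b : ℕ} {l r : BinaryTree ℕ} :
    b ∈ sideLabels c d (.node a l r) ↔
      (d = c ∧ b = a) ∨ b ∈ sideLabels c .L l ∨ b ∈ sideLabels c .R r := by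
  rw [sideLabels, Multiset.mem_add, Multiset.mem_add, or_assoc]
  split_ifs with h <;> simp [h]

/-- A new row is opened only by a left child. The row of the parent enters a subtree only if the
root of the subtree is a right child. -/
theorem fst_mem_of_mem_labelPositions {t : BinaryTree ℕ} {d : Side} {x y : ℕ} {p : ℕ × ℕ}
    (hp : p ∈ labelPositions d x y t) : p.1 ∈ sideLabels .L d t ∨ (d = .R ∧ p.1 = x) := by
  induction t generalizing d x y with
  | nil => cases d <;> simp [labelPositions] at hp
  | node a l r ihl ihr =>
    cases d <;> simp only [labelPositions, Finset.mem_insert, Finset.mem_union] at hp <;>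
      simp only [mem_sideLabels_node] <;>
      rcases hp with rfl | hp | hp
    · simp
    · rcases ihl hp with h | ⟨h, -⟩
      · simp [h]
      · cases h
    · rcases ihr hp with h | ⟨-, h⟩
      · simp [h]
      · simp [h]
    · simp
    · rcases ihl hp with h | ⟨h, -⟩
      · simp [h]
      · cases h
    · rcases ihr hp with h | ⟨-, h⟩
      · simp [h]
      · simp [h]

theorem snd_mem_of_mem_labelPositions {t : BinaryTree ℕ} {d : Side} {x y : ℕ} {p : ℕ × ℕ}
    (hp : p ∈ labelPositions d x y t) : p.2 ∈ sideLabels .R d t ∨ (d = .L ∧ p.2 = y) := by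
  induction t generalizing d x y with
  | nil => cases d <;> simp [labelPositions] at hp
  | node a l r ihl ihr =>
    cases d <;> simp only [labelPositions, Finset.mem_insert, Finset.mem_union] at hp <;>
      simp only [mem_sideLabels_node] <;>
      rcases hp with rfl | hp | hp
    · simp
    · rcases ihl hp with h | ⟨-, h⟩
      · simp [h]
      · simp [h]
    · rcases ihr hp with h | ⟨h, -⟩
      · simp [h]
      · cases h
    · simp
    · rcases ihl hp with h | ⟨-, h⟩
      · simp [h]
      · simp [h]
    · rcases ihr hp with h | ⟨h, -⟩
      · simp [h]
      · cases h

theorem exists_fst_eq_of_mem_sideLabels {t : BinaryTree ℕ} {d : Side} (x y : ℕ) {a : ℕ}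
    (ha : a ∈ sideLabels .L d t) : ∃ p ∈ labelPositions d x y t, p.1 = a := by
  induction t generalizing d x y with
  | nil => cases d <;> simp [sideLabels] at ha
  | node b l r ihl ihr =>
    rw [mem_sideLabels_node] at ha
    rcases ha with ⟨rfl, rfl⟩ | ha | ha
    · exact ⟨(a, y), by simp [labelPositions], rfl⟩
    · cases d
      · obtain ⟨p, hp, h⟩ := ihl b y ha
        exact ⟨p, by simp [labelPositions, hp], h⟩
      · obtain ⟨p, hp, h⟩ := ihl x b ha
        exact ⟨p, by simp [labelPositions, hp], h⟩
    · cases d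
      · obtain ⟨p, hp, h⟩ := ihr b y ha
        exact ⟨p, by simp [labelPositions, hp], h⟩
      · obtain ⟨p, hp, h⟩ := ihr x b ha
        exact ⟨p, by simp [labelPositions, hp], h⟩

theorem exists_snd_eq_of_mem_sideLabels {t : BinaryTree ℕ} {d : Side} (x y : ℕ) {a : ℕ}
    (ha : a ∈ sideLabels .R d t) : ∃ p ∈ labelPositions d x y t, p.2 = a := by
  induction t generalizing d x y with
  | nil => cases d <;> simp [sideLabels] at ha
  | node b l r ihl ihr =>
    rw [mem_sideLabels_node] at ha
    rcases ha with ⟨rfl, rfl⟩ | ha | ha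
    · exact ⟨(x, a), by simp [labelPositions], rfl⟩
    · cases d
      · obtain ⟨p, hp, h⟩ := ihl b y ha
        exact ⟨p, by simp [labelPositions, hp], h⟩
      · obtain ⟨p, hp, h⟩ := ihl x b ha
        exact ⟨p, by simp [labelPositions, hp], h⟩
    · cases d
      · obtain ⟨p, hp, h⟩ := ihr b y ha
        exact ⟨p, by simp [labelPositions, hp], h⟩
      · obtain ⟨p, hp, h⟩ := ihr x b ha
        exact ⟨p, by simp [labelPositions, hp], h⟩

/-- The vertex at `(x, y)` of a tree with point set `P` has left subtree `l` and right
subtree `r`. -/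
structure IsChildrenOf (P : Finset (ℕ × ℕ)) (x y : ℕ) (l r : BinaryTree ℕ) : Prop where
  greater_left : AncestorsGreater .L l
  greater_right : AncestorsGreater .R r
  subset : labelPositions .L x y l ∪ labelPositions .R x y r ⊆ P
  nodup_left : (sideLabels .L .L l + sideLabels .L .R r).Nodup
  nodup_right : (sideLabels .R .L l + sideLabels .R .R r).Nodup
  lt_left : ∀ a ∈ sideLabels .L .L l + sideLabels .L .R r, a < x
  lt_right : ∀ a ∈ sideLabels .R .L l + sideLabels .R .R r, a < y
  row : ∀ p ∈ P, p.1 ∈ sideLabels .L .L l + sideLabels .L .R r →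
    p ∈ labelPositions .L x y l ∪ labelPositions .R x y r
  column : ∀ p ∈ P, p.2 ∈ sideLabels .R .L l + sideLabels .R .R r →
    p ∈ labelPositions .L x y l ∪ labelPositions .R x y r
  below : ∀ p ∈ P, p.2 = y → p.1 < x → p ∈ labelPositions .L x y l ∪ labelPositions .R x y r
  beside : ∀ p ∈ P, p.1 = x → p.2 < y → p ∈ labelPositions .L x y l ∪ labelPositions .R x y r

/-- The vertex at `(x, y)` of a tree with point set `P` has subtree `t` on the side `d`. -/
structure IsSubtreeOf (P : Finset (ℕ × ℕ)) (d : Side) (x y : ℕ) (t : BinaryTree ℕ) :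
    Prop where
  greater : AncestorsGreater d t
  subset : labelPositions d x y t ⊆ P
  nodup_left : (sideLabels .L d t).Nodup
  nodup_right : (sideLabels .R d t).Nodup
  lt_left : ∀ a ∈ sideLabels .L d t, a < x
  lt_right : ∀ a ∈ sideLabels .R d t, a < y
  row : ∀ p ∈ P, p.1 ∈ sideLabels .L d t → p ∈ labelPositions d x y t
  column : ∀ p ∈ P, p.2 ∈ sideLabels .R d t → p ∈ labelPositions d x y t
  below : d = .L → ∀ p ∈ P, p.2 = y → p.1 < x → p ∈ labelPositions d x y t
  beside : d = .R → ∀ p ∈ P, p.1 = x → p.2 < y → p ∈ labelPositions d x y t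

variable {P : Finset (ℕ × ℕ)} {x y a : ℕ} {l r t : BinaryTree ℕ} {d : Side}

/-- The two subtrees use disjoint sets of labels. The right one meets neither column `y` nor the
rows of the left one, so points located by such a row or column must be in the left one. -/
theorem IsChildrenOf.left (h : IsChildrenOf P x y l r) : IsSubtreeOf P .L x y l := by
  have key : ∀ p ∈ labelPositions .L x y l ∪ labelPositions .R x y r,
      p.2 ∉ sideLabels .R .R r → p ∈ labelPositions .L x y l := by
    intro p hp hp2
    rcases Finset.mem_union.1 hp with hp | hp
    · exact hp
    · rcases snd_mem_of_mem_labelPositions hp with h' | ⟨h', -⟩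
      · exact absurd h' hp2
      · cases h'
  have key' : ∀ p ∈ labelPositions .L x y l ∪ labelPositions .R x y r,
      p.1 ∉ sideLabels .L .R r → p.1 ≠ x → p ∈ labelPositions .L x y l := by
    intro p hp hp2 hpx
    rcases Finset.mem_union.1 hp with hp | hp
    · exact hp
    · rcases fst_mem_of_mem_labelPositions hp with h' | ⟨-, h'⟩
      · exact absurd h' hp2
      · exact absurd h' hpx
  have hlt : ∀ a ∈ sideLabels .L .L l, a < x := fun a ha =>
    h.lt_left a (Multiset.mem_add.2 (Or.inl ha))
  exact
  { greater := h.greater_left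
    subset := Finset.subset_union_left.trans h.subset
    nodup_left := (Multiset.nodup_add.1 h.nodup_left).1
    nodup_right := (Multiset.nodup_add.1 h.nodup_right).1
    lt_left := hlt
    lt_right := fun a ha => h.lt_right a (Multiset.mem_add.2 (Or.inl ha))
    row := fun p hp h1 => key' p (h.row p hp (Multiset.mem_add.2 (Or.inl h1)))
      (fun h2 => Multiset.disjoint_left.1 (Multiset.nodup_add.1 h.nodup_left).2.2 h1 h2)
      (hlt _ h1).ne
    column := fun p hp h1 => key p (h.column p hp (Multiset.mem_add.2 (Or.inl h1)))
      (fun h2 => Multiset.disjoint_left.1 (Multiset.nodup_add.1 h.nodup_right).2.2 h1 h2)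
    below := fun _ p hp h1 h2 => key p (h.below p hp h1 h2)
      (fun h3 => (h.lt_right _ (Multiset.mem_add.2 (Or.inr h3))).ne h1)
    beside := fun h' => by cases h' }

theorem IsChildrenOf.right (h : IsChildrenOf P x y l r) : IsSubtreeOf P .R x y r := by
  have key : ∀ p ∈ labelPositions .L x y l ∪ labelPositions .R x y r,
      p.1 ∉ sideLabels .L .L l → p ∈ labelPositions .R x y r := by
    intro p hp hp2
    rcases Finset.mem_union.1 hp with hp | hp
    · rcases fst_mem_of_mem_labelPositions hp with h' | ⟨h', -⟩
      · exact absurd h' hp2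
      · cases h'
    · exact hp
  have key' : ∀ p ∈ labelPositions .L x y l ∪ labelPositions .R x y r,
      p.2 ∉ sideLabels .R .L l → p.2 ≠ y → p ∈ labelPositions .R x y r := by
    intro p hp hp2 hpx
    rcases Finset.mem_union.1 hp with hp | hp
    · rcases snd_mem_of_mem_labelPositions hp with h' | ⟨-, h'⟩
      · exact absurd h' hp2
      · exact absurd h' hpx
    · exact hp
  have hlt : ∀ a ∈ sideLabels .R .R r, a < y := fun a ha =>
    h.lt_right a (Multiset.mem_add.2 (Or.inr ha))
  exact
  { greater := h.greater_right
    subset := Finset.subset_union_right.trans h.subset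
    nodup_left := (Multiset.nodup_add.1 h.nodup_left).2.1
    nodup_right := (Multiset.nodup_add.1 h.nodup_right).2.1
    lt_left := fun a ha => h.lt_left a (Multiset.mem_add.2 (Or.inr ha))
    lt_right := hlt
    row := fun p hp h1 => key p (h.row p hp (Multiset.mem_add.2 (Or.inr h1)))
      (fun h2 => Multiset.disjoint_left.1 (Multiset.nodup_add.1 h.nodup_left).2.2 h2 h1)
    column := fun p hp h1 => key' p (h.column p hp (Multiset.mem_add.2 (Or.inr h1)))
      (fun h2 => Multiset.disjoint_left.1 (Multiset.nodup_add.1 h.nodup_right).2.2 h2 h1)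
      (hlt _ h1).ne
    below := fun h' => by cases h'
    beside := fun _ p hp h1 h2 => key p (h.beside p hp h1 h2)
      (fun h3 => (h.lt_left _ (Multiset.mem_add.2 (Or.inl h3))).ne h1) }

/-- The left child opens row `a`, so the `row` clause of the subtree becomes the `beside` clause of
the child; its `below` clause is inherited, as the child stays in column `y`. -/
theorem IsSubtreeOf.children_left (h : IsSubtreeOf P .L x y (.node a l r)) :
    IsChildrenOf P a y l r := by
  have hmem : ∀ p ∈ labelPositions .L x y (.node a l r), (p.1 = a → p.2 ≠ y) →
      p ∈ labelPositions .L a y l ∪ labelPositions .R a y r := fun p hp hne =>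
    (Finset.mem_insert.1 hp).resolve_left fun h' =>
      hne (Prod.ext_iff.1 h').1 (Prod.ext_iff.1 h').2
  have hL : sideLabels .L .L (.node a l r) =
      a ::ₘ (sideLabels .L .L l + sideLabels .L .R r) := by
    simp [sideLabels, Multiset.cons_add]
  have hR : sideLabels .R .L (.node a l r) = sideLabels .R .L l + sideLabels .R .R r := by
    simp [sideLabels]
  have hlt := h.greater.1
  have hax : a < x := h.lt_left a (by rw [hL]; exact Multiset.mem_cons_self _ _)
  have hnd := h.nodup_left
  rw [hL, Multiset.nodup_cons] at hnd
  have hlty : ∀ b ∈ sideLabels .R .L l + sideLabels .R .R r, b < y := fun b hb =>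
    h.lt_right b (hR ▸ hb)
  exact
  { greater_left := h.greater.2.1
    greater_right := h.greater.2.2
    subset := (Finset.subset_insert _ _).trans h.subset
    nodup_left := hnd.2
    nodup_right := hR ▸ h.nodup_right
    lt_left := hlt
    lt_right := hlty
    row := fun p hp h1 => hmem p (h.row p hp (hL ▸ Multiset.mem_cons_of_mem h1))
      fun h2 => absurd h2 (hlt _ h1).ne
    column := fun p hp h1 => hmem p (h.column p hp (hR ▸ h1)) fun _ => (hlty _ h1).ne
    below := fun p hp h1 h2 => hmem p (h.below rfl p hp h1 (h2.trans hax))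
      fun h3 => absurd h3 h2.ne
    beside := fun p hp h1 h2 => hmem p
      (h.row p hp (by rw [hL, h1]; exact Multiset.mem_cons_self _ _)) fun _ => h2.ne }

theorem IsSubtreeOf.children_right (h : IsSubtreeOf P .R x y (.node a l r)) :
    IsChildrenOf P x a l r := by
  have hmem : ∀ p ∈ labelPositions .R x y (.node a l r), (p.1 = x → p.2 ≠ a) →
      p ∈ labelPositions .L x a l ∪ labelPositions .R x a r := fun p hp hne =>
    (Finset.mem_insert.1 hp).resolve_left fun h' =>
      hne (Prod.ext_iff.1 h').1 (Prod.ext_iff.1 h').2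
  have hR : sideLabels .R .R (.node a l r) =
      a ::ₘ (sideLabels .R .L l + sideLabels .R .R r) := by
    simp [sideLabels, Multiset.cons_add]
  have hL : sideLabels .L .R (.node a l r) = sideLabels .L .L l + sideLabels .L .R r := by
    simp [sideLabels]
  have hlt := h.greater.1
  have hay : a < y := h.lt_right a (by rw [hR]; exact Multiset.mem_cons_self _ _)
  have hnd := h.nodup_right
  rw [hR, Multiset.nodup_cons] at hnd
  have hltx : ∀ b ∈ sideLabels .L .L l + sideLabels .L .R r, b < x := fun b hb =>
    h.lt_left b (hL ▸ hb)
  exact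
  { greater_left := h.greater.2.1
    greater_right := h.greater.2.2
    subset := (Finset.subset_insert _ _).trans h.subset
    nodup_left := hL ▸ h.nodup_left
    nodup_right := hnd.2
    lt_left := hltx
    lt_right := hlt
    row := fun p hp h1 => hmem p (h.row p hp (hL ▸ h1))
      fun h2 => absurd h2 (hltx _ h1).ne
    column := fun p hp h1 => hmem p (h.column p hp (hR ▸ Multiset.mem_cons_of_mem h1))
      fun _ => (hlt _ h1).ne
    below := fun p hp h1 h2 => hmem p
      (h.column p hp (by rw [hR, h1]; exact Multiset.mem_cons_self _ _))
      fun h3 => absurd h3 h2.ne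
    beside := fun p hp h1 h2 => hmem p (h.beside rfl p hp h1 (h2.trans hay)) fun _ => h2.ne }

/-- A labelled tree is determined by its point set. -/
theorem IsSubtreeOf.eq (h : IsSubtreeOf P d x y t) {t' : BinaryTree ℕ}
    (h' : IsSubtreeOf P d x y t') : t = t' := by
  induction t generalizing d x y t' with
  | nil =>
    cases t' with
    | nil => rfl
    | node a l r =>
      cases d
      · have := h.below rfl (a, y) (h'.subset (by simp [labelPositions])) rfl
          (h'.lt_left a (by simp [mem_sideLabels_node]))
        simp [labelPositions] at this
      · have := h.beside rfl (x, a) (h'.subset (by simp [labelPositions])) rfl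
          (h'.lt_right a (by simp [mem_sideLabels_node]))
        simp [labelPositions] at this
  | node a l r ihl ihr =>
    cases t' with
    | nil =>
      cases d
      · have := h'.below rfl (a, y) (h.subset (by simp [labelPositions])) rfl
          (h.lt_left a (by simp [mem_sideLabels_node]))
        simp [labelPositions] at this
      · have := h'.beside rfl (x, a) (h.subset (by simp [labelPositions])) rfl
          (h.lt_right a (by simp [mem_sideLabels_node]))
        simp [labelPositions] at this
    | node a' l' r' =>
      cases d
      -- Each root lies below `(x, y)` in column `y` and hence belongs to the other subtree as well,
      -- where the root has the largest left label.
      · have hle : ∀ {a a' l l' r r'}, IsSubtreeOf P .L x y (.node a l r) →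
            IsSubtreeOf P .L x y (.node a' l' r') → a ≤ a' := by
          intro a a' l l' r r' h h'
          have := h'.below rfl (a, y) (h.subset (by simp [labelPositions])) rfl
            (h.lt_left a (by simp [mem_sideLabels_node]))
          rcases fst_mem_of_mem_labelPositions this with h1 | ⟨h1, -⟩
          · rw [mem_sideLabels_node, ← Multiset.mem_add] at h1
            rcases h1 with ⟨-, h1⟩ | h1
            · exact h1.le
            · exact (h'.greater.1 _ h1).le
          · cases h1
        obtain rfl : a = a' := le_antisymm (hle h h') (hle h' h)
        rw [ihl h.children_left.left h'.children_left.left,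
          ihr h.children_left.right h'.children_left.right]
      · have hle : ∀ {a a' l l' r r'}, IsSubtreeOf P .R x y (.node a l r) →
            IsSubtreeOf P .R x y (.node a' l' r') → a ≤ a' := by
          intro a a' l l' r r' h h'
          have := h'.beside rfl (x, a) (h.subset (by simp [labelPositions])) rfl
            (h.lt_right a (by simp [mem_sideLabels_node]))
          rcases snd_mem_of_mem_labelPositions this with h1 | ⟨h1, -⟩
          · rw [mem_sideLabels_node, ← Multiset.mem_add] at h1
            rcases h1 with ⟨-, h1⟩ | h1
            · exact h1.le
            · exact (h'.greater.1 _ h1).le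
          · cases h1
        obtain rfl : a = a' := le_antisymm (hle h h') (hle h' h)
        rw [ihl h.children_right.left h'.children_right.left,
          ihr h.children_right.right h'.children_right.right]

/-- Every point of a subtree has a point above it or to its left, but not both. -/
theorem IsSubtreeOf.parent (h : IsSubtreeOf P d x y t) (hxy : (x, y) ∈ P) :
    ∀ p ∈ labelPositions d x y t,
      ((∃ u, p.1 < u ∧ (u, p.2) ∈ P) ∨ ∃ v, p.2 < v ∧ (p.1, v) ∈ P) ∧
        ∀ u v, p.1 < u → (u, p.2) ∈ P → p.2 < v → (p.1, v) ∉ P := by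
  induction t generalizing d x y with
  | nil => cases d <;> simp [labelPositions]
  | node a l r ihl ihr =>
    intro p hp
    cases d
    · have hc := h.children_left
      have ha : a ∈ sideLabels .L .L (.node a l r) := by simp [mem_sideLabels_node]
      have haP : (a, y) ∈ P := h.subset (by simp [labelPositions])
      simp only [labelPositions, Finset.mem_insert, Finset.mem_union] at hp
      rcases hp with rfl | hp | hp
      -- A point to the left in row `a` would belong to this subtree, whose columns have labels at
      -- most `y`; larger labels lie further left.
      · refine ⟨Or.inl ⟨x, h.lt_left a ha, hxy⟩, fun u v _ _ hv hvP => ?_⟩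
        rcases snd_mem_of_mem_labelPositions (h.row (a, v) hvP ha) with h1 | ⟨-, h1⟩
        · exact lt_asymm hv (h.lt_right _ h1)
        · exact hv.ne' h1
      · exact ihl hc.left haP p hp
      · exact ihr hc.right haP p hp
    · have hc := h.children_right
      have ha : a ∈ sideLabels .R .R (.node a l r) := by simp [mem_sideLabels_node]
      have haP : (x, a) ∈ P := h.subset (by simp [labelPositions])
      simp only [labelPositions, Finset.mem_insert, Finset.mem_union] at hp
      rcases hp with rfl | hp | hp
      · refine ⟨Or.inr ⟨y, h.lt_right a ha, hxy⟩, fun u v hu huP _ _ => ?_⟩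
        rcases fst_mem_of_mem_labelPositions (h.column (u, a) huP ha) with h1 | ⟨-, h1⟩
        · exact lt_asymm hu (h.lt_left _ h1)
        · exact hu.ne' h1
      · exact ihl hc.left haP p hp
      · exact ihr hc.right haP p hp

end Trees

/-! ### Geometric presentations of non-ambiguous trees. -/

namespace NonAmbiguousTree

/-- The point set of `T` in label coordinates. -/
def points (T : NonAmbiguousTree) : Finset (ℕ × ℕ) :=
  insert (T.wL, T.wR) (labelPositions .L T.wL T.wR T.left ∪ labelPositions .R T.wL T.wR T.right)

variable {T : NonAmbiguousTree}

theorem mem_leftLabels {a : ℕ} :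
    a ∈ sideLabels .L .L T.left + sideLabels .L .R T.right ↔ 1 ≤ a ∧ a < T.wL := by
  rw [T.leftLabels_eq, Finset.mem_val, Finset.mem_Icc, wL, Nat.lt_succ_iff]

theorem mem_rightLabels {a : ℕ} :
    a ∈ sideLabels .R .L T.left + sideLabels .R .R T.right ↔ 1 ≤ a ∧ a < T.wR := by
  rw [T.rightLabels_eq, Finset.mem_val, Finset.mem_Icc, wR, Nat.lt_succ_iff]

theorem isChildrenOf (T : NonAmbiguousTree) :
    IsChildrenOf T.points T.wL T.wR T.left T.right where
  greater_left := T.left_greater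
  greater_right := T.right_greater
  subset := Finset.subset_insert _ _
  nodup_left := by rw [T.leftLabels_eq]; exact Finset.nodup _
  nodup_right := by rw [T.rightLabels_eq]; exact Finset.nodup _
  lt_left a ha := (mem_leftLabels.1 ha).2
  lt_right a ha := (mem_rightLabels.1 ha).2
  row p hp h := (Finset.mem_insert.1 hp).resolve_left fun h' =>
    (mem_leftLabels.1 h).2.ne (Prod.ext_iff.1 h').1
  column p hp h := (Finset.mem_insert.1 hp).resolve_left fun h' =>
    (mem_rightLabels.1 h).2.ne (Prod.ext_iff.1 h').2
  below p hp _ h := (Finset.mem_insert.1 hp).resolve_left fun h' => h.ne (Prod.ext_iff.1 h').1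
  beside p hp _ h := (Finset.mem_insert.1 hp).resolve_left fun h' => h.ne (Prod.ext_iff.1 h').2

/-- Within these bounds the truncated subtractions of the change of coordinates lose nothing, which
`mem_cells` relies on. -/
theorem bounds_of_mem_points {p : ℕ × ℕ} (hp : p ∈ T.points) :
    (1 ≤ p.1 ∧ p.1 ≤ T.wL) ∧ 1 ≤ p.2 ∧ p.2 ≤ T.wR := by
  have hL : 1 ≤ T.wL := Nat.succ_pos _
  have hR : 1 ≤ T.wR := Nat.succ_pos _
  have h1 : ∀ a, a ∈ sideLabels .L .L T.left ∨ a ∈ sideLabels .L .R T.right →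
      1 ≤ a ∧ a ≤ T.wL := fun a ha =>
    (mem_leftLabels.1 (Multiset.mem_add.2 ha)).imp_right le_of_lt
  have h2 : ∀ a, a ∈ sideLabels .R .L T.left ∨ a ∈ sideLabels .R .R T.right →
      1 ≤ a ∧ a ≤ T.wR := fun a ha =>
    (mem_rightLabels.1 (Multiset.mem_add.2 ha)).imp_right le_of_lt
  rcases Finset.mem_insert.1 hp with rfl | hp
  · exact ⟨⟨hL, le_rfl⟩, hR, le_rfl⟩
  · rcases Finset.mem_union.1 hp with hp | hp
    · constructor
      · rcases fst_mem_of_mem_labelPositions hp with h | ⟨-, h⟩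
        · exact h1 _ (Or.inl h)
        · exact ⟨h ▸ hL, h.le⟩
      · rcases snd_mem_of_mem_labelPositions hp with h | ⟨-, h⟩
        · exact h2 _ (Or.inl h)
        · exact ⟨h ▸ hR, h.le⟩
    · constructor
      · rcases fst_mem_of_mem_labelPositions hp with h | ⟨-, h⟩
        · exact h1 _ (Or.inr h)
        · exact ⟨h ▸ hL, h.le⟩
      · rcases snd_mem_of_mem_labelPositions hp with h | ⟨-, h⟩
        · exact h2 _ (Or.inr h)
        · exact ⟨h ▸ hR, h.le⟩

theorem mem_cells {p : Fin T.wL × Fin T.wR} :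
    p ∈ T.cells T.wL T.wR ↔ (T.wL - p.1.val, T.wR - p.2.val) ∈ T.points := by
  have h1 := p.1.isLt
  have h2 := p.2.isLt
  rw [cells, Finset.mem_filter, geometricPresentation, Finset.mem_image]
  constructor
  · rintro ⟨-, q, hq, h⟩
    have hb := bounds_of_mem_points (T := T) hq
    simp only [Prod.mk.injEq] at h
    have : (T.wL - p.1.val, T.wR - p.2.val) = q := Prod.ext (by simp only; omega)
      (by simp only; omega)
    exact this ▸ hq
  · intro h
    exact ⟨Finset.mem_univ _, _, h, Prod.ext (by simp only; omega) (by simp only; omega)⟩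

theorem exists_cell {a b : ℕ} (h : (a, b) ∈ T.points) :
    ∃ p ∈ T.cells T.wL T.wR, p.1.val = T.wL - a ∧ p.2.val = T.wR - b := by
  have hb := bounds_of_mem_points h
  simp only at hb
  refine ⟨(⟨T.wL - a, by omega⟩, ⟨T.wR - b, by omega⟩), mem_cells.2 ?_, rfl, rfl⟩
  simp only
  rwa [Nat.sub_sub_self hb.1.2, Nat.sub_sub_self hb.2.2]

theorem wL_pos : 0 < T.wL := Nat.succ_pos _

theorem wR_pos : 0 < T.wR := Nat.succ_pos _

/-- The parent clauses are those of `IsSubtreeOf.parent` with the orders reversed by the change of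
coordinates. No row or column is empty because each label occurs. -/
theorem isNonAmbiguous (T : NonAmbiguousTree) :
    IsNonAmbiguous ⟨0, T.wL_pos⟩ ⟨0, T.wR_pos⟩ (T.cells T.wL T.wR) Finset.univ Finset.univ := by
  have hroot : (T.wL, T.wR) ∈ T.points := Finset.mem_insert_self _ _
  have hparent : ∀ p ∈ T.points, p ≠ (T.wL, T.wR) →
      ((∃ u, p.1 < u ∧ (u, p.2) ∈ T.points) ∨ ∃ v, p.2 < v ∧ (p.1, v) ∈ T.points) ∧
        ∀ u v, p.1 < u → (u, p.2) ∈ T.points → p.2 < v → (p.1, v) ∉ T.points := by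
    intro p hp hne
    rcases Finset.mem_union.1 ((Finset.mem_insert.1 hp).resolve_left hne) with hp | hp
    · exact T.isChildrenOf.left.parent hroot p hp
    · exact T.isChildrenOf.right.parent hroot p hp
  have hrootcell : (⟨⟨0, T.wL_pos⟩, ⟨0, T.wR_pos⟩⟩ : Fin T.wL × Fin T.wR) ∈ T.cells T.wL T.wR :=
    mem_cells.2 hroot
  have hne : ∀ p : Fin T.wL × Fin T.wR, p ≠ (⟨0, T.wL_pos⟩, ⟨0, T.wR_pos⟩) →
      (T.wL - p.1.val, T.wR - p.2.val) ≠ (T.wL, T.wR) := by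
    rintro ⟨⟨u, hu⟩, ⟨v, hv⟩⟩ hp h
    simp only [Prod.mk.injEq] at h
    apply hp
    simp only [Prod.mk.injEq, Fin.mk.injEq]
    omega
  refine ⟨hrootcell, fun p _ => ⟨Nat.zero_le _, Nat.zero_le _⟩, by simp, ?_, ?_, ?_, ?_⟩
  · rintro ⟨x, hx⟩ -
    rcases Nat.eq_zero_or_pos x with rfl | hpos
    · exact ⟨_, hrootcell⟩
    · have hmem : T.wL - x ∈ sideLabels .L .L T.left + sideLabels .L .R T.right :=
        mem_leftLabels.2 (by omega)
      obtain ⟨p, hp, hpx⟩ : ∃ p ∈ T.points, p.1 = T.wL - x := by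
        rcases Multiset.mem_add.1 hmem with h | h
        · obtain ⟨p, hp, h'⟩ := exists_fst_eq_of_mem_sideLabels T.wL T.wR h
          exact ⟨p, T.isChildrenOf.left.subset hp, h'⟩
        · obtain ⟨p, hp, h'⟩ := exists_fst_eq_of_mem_sideLabels T.wL T.wR h
          exact ⟨p, T.isChildrenOf.right.subset hp, h'⟩
      obtain ⟨q, hq, hq1, -⟩ := exists_cell hp
      refine ⟨q.2, ?_⟩
      have : (⟨x, hx⟩ : Fin T.wL) = q.1 := Fin.ext (by simp only; omega)
      rw [this]
      exact hq
  · rintro ⟨x, hx⟩ -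
    rcases Nat.eq_zero_or_pos x with rfl | hpos
    · exact ⟨_, hrootcell⟩
    · have hmem : T.wR - x ∈ sideLabels .R .L T.left + sideLabels .R .R T.right :=
        mem_rightLabels.2 (by omega)
      obtain ⟨p, hp, hpx⟩ : ∃ p ∈ T.points, p.2 = T.wR - x := by
        rcases Multiset.mem_add.1 hmem with h | h
        · obtain ⟨p, hp, h'⟩ := exists_snd_eq_of_mem_sideLabels T.wL T.wR h
          exact ⟨p, T.isChildrenOf.left.subset hp, h'⟩
        · obtain ⟨p, hp, h'⟩ := exists_snd_eq_of_mem_sideLabels T.wL T.wR h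
          exact ⟨p, T.isChildrenOf.right.subset hp, h'⟩
      obtain ⟨q, hq, -, hq2⟩ := exists_cell hp
      refine ⟨q.1, ?_⟩
      have : (⟨x, hx⟩ : Fin T.wR) = q.2 := Fin.ext (by simp only; omega)
      rw [this]
      exact hq
  · rintro p hp hp0
    have h1 := p.1.isLt
    have h2 := p.2.isLt
    rcases (hparent _ (mem_cells.1 hp) (hne p hp0)).1 with ⟨u, hu, huP⟩ | ⟨v, hv, hvP⟩
    · obtain ⟨q, hq, hq1, hq2⟩ := exists_cell huP
      have hb := bounds_of_mem_points huP
      simp only at hb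
      have : q = (q.1, p.2) := Prod.ext rfl (Fin.ext (by simp only at hq2 ⊢; omega))
      exact Or.inl ⟨q.1, by rw [Fin.lt_def]; simp only at hu; omega, this ▸ hq⟩
    · obtain ⟨q, hq, hq1, hq2⟩ := exists_cell hvP
      have hb := bounds_of_mem_points hvP
      simp only at hb
      have : q = (p.1, q.2) := Prod.ext (Fin.ext (by simp only at hq1 ⊢; omega)) rfl
      exact Or.inr ⟨q.2, by rw [Fin.lt_def]; simp only at hv; omega, this ▸ hq⟩
  · intro p hp u v hu huA hv hvA
    have h1 := p.1.isLt
    have h2 := p.2.isLt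
    rw [Fin.lt_def] at hu hv
    refine (hparent _ (mem_cells.1 hp) (hne p ?_)).2 (T.wL - u.val) (T.wR - v.val)
      (by simp only; omega) (mem_cells.1 huA) (by simp only; omega) (mem_cells.1 hvA)
    rintro rfl
    exact absurd hu (Nat.not_lt_zero _)

theorem eq_of_cells_eq {m n : ℕ} {T T' : NonAmbiguousTree} (hL : T.wL = m) (hR : T.wR = n)
    (hL' : T'.wL = m) (hR' : T'.wR = n) (h : T.cells m n = T'.cells m n) : T = T' := by
  have hsub : ∀ {T T' : NonAmbiguousTree}, T.wL = m → T.wR = n → T'.wL = m → T'.wR = n →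
      T.cells m n = T'.cells m n → T.points ⊆ T'.points := by
    rintro T T' rfl rfl hL' hR' h ⟨a, b⟩ hp
    obtain ⟨q, hq, hq1, hq2⟩ := exists_cell hp
    have hb := bounds_of_mem_points hp
    rw [h] at hq
    obtain ⟨c, hc, hc'⟩ := Finset.mem_image.1 (Finset.mem_filter.1 hq).2
    have hb' := bounds_of_mem_points (T := T') hc
    simp only [Prod.mk.injEq] at hc' hb
    have : c = (a, b) := Prod.ext (by simp only; omega) (by simp only; omega)
    exact this ▸ hc
  have hP : T.points = T'.points :=
    (hsub hL hR hL' hR' h).antisymm (hsub hL' hR' hL hR h.symm)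
  have hT := T.isChildrenOf
  have hT' := T'.isChildrenOf
  rw [← hP, hL', hR'] at hT'
  rw [hL, hR] at hT
  have h1 := hT.left.eq hT'.left
  have h2 := hT.right.eq hT'.right
  cases T
  cases T'
  simp only at h1 h2
  subst h1 h2
  rfl

end NonAmbiguousTree

/-! ### Attaching leaves to labelled trees. -/

section LeafInsertion

/-- In the tree `t`, a new left leaf with a small label can be attached to every vertex without
left child. -/
def LeftLeafInsertable (d : Side) (t : BinaryTree ℕ) : Prop :=
  ∀ (x y : ℕ) (q : ℕ × ℕ) (c : ℕ), AncestorsGreater d t → (∀ a ∈ sideLabels .L d t, a < x) →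
    q ∈ labelPositions d x y t → c < q.1 → (∀ u, (u, q.2) ∈ labelPositions d x y t → q.1 ≤ u) →
    ∃ t', AncestorsGreater d t' ∧ sideLabels .L d t' = c ::ₘ sideLabels .L d t ∧
      sideLabels .R d t' = sideLabels .R d t ∧
      labelPositions d x y t' = insert (c, q.2) (labelPositions d x y t)

/-- If `q` is the vertex itself, its left subtree is empty, since a left child would be a lower
point of the same column; the leaf goes there. Otherwise the leaf goes into the subtree that
contains `q`. -/
theorem exists_children_insert_left_leaf {l r : BinaryTree ℕ} (hl : LeftLeafInsertable .L l)
    (hr : LeftLeafInsertable .R r) {x y : ℕ} {q : ℕ × ℕ} {c : ℕ} (hgl : AncestorsGreater .L l)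
    (hgr : AncestorsGreater .R r)
    (hlt : ∀ a ∈ sideLabels .L .L l + sideLabels .L .R r, a < x)
    (hq : q ∈ insert (x, y) (labelPositions .L x y l ∪ labelPositions .R x y r))
    (hc : c < q.1)
    (hlow : ∀ u, (u, q.2) ∈ insert (x, y) (labelPositions .L x y l ∪ labelPositions .R x y r) →
      q.1 ≤ u) :
    ∃ l' r', AncestorsGreater .L l' ∧ AncestorsGreater .R r' ∧
      sideLabels .L .L l' + sideLabels .L .R r' =
        c ::ₘ (sideLabels .L .L l + sideLabels .L .R r) ∧
      sideLabels .R .L l' + sideLabels .R .R r' = sideLabels .R .L l + sideLabels .R .R r ∧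
      labelPositions .L x y l' ∪ labelPositions .R x y r' =
        insert (c, q.2) (labelPositions .L x y l ∪ labelPositions .R x y r) := by
  simp only [Finset.mem_insert, Finset.mem_union] at hq hlow
  rcases hq with rfl | hq | hq
  · cases l with
    | node a l₁ l₂ =>
      have h1 := hlow a (by simp [labelPositions])
      have h2 := hlt a (by simp [mem_sideLabels_node])
      exact absurd h1 (not_le.2 h2)
    | nil =>
      refine ⟨.node c .nil .nil, r, ?_, hgr, ?_, ?_, ?_⟩
      · simp [AncestorsGreater, sideLabels]
      · simp [sideLabels]
      · simp [sideLabels]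
      · simp [labelPositions]
  · obtain ⟨l', h1, h2, h3, h4⟩ := hl x y q c hgl
      (fun a ha => hlt a (Multiset.mem_add.2 (Or.inl ha))) hq hc
      fun u hu => hlow u (Or.inr (Or.inl hu))
    exact ⟨l', r, h1, hgr, by rw [h2, Multiset.cons_add], by rw [h3],
      by rw [h4, Finset.insert_union]⟩
  · obtain ⟨r', h1, h2, h3, h4⟩ := hr x y q c hgr
      (fun a ha => hlt a (Multiset.mem_add.2 (Or.inr ha))) hq hc
      fun u hu => hlow u (Or.inr (Or.inr hu))
    exact ⟨l, r', hgl, h1, by rw [h2, Multiset.add_cons], by rw [h3],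
      by rw [h4, Finset.union_insert]⟩

theorem leftLeafInsertable (d : Side) (t : BinaryTree ℕ) : LeftLeafInsertable d t := by
  induction t generalizing d with
  | nil =>
    intro x y q c _ _ hq
    cases d <;> simp [labelPositions] at hq
  | node a l r ihl ihr =>
    intro x y q c hg hlt hq hc hlow
    cases d
    -- The row labels in this subtree are at most `a`, so `c < q.1 ≤ a` and the new leaf respects
    -- its ancestor `a`.
    · have hca : c < a := by
        refine hc.trans_le ?_
        rcases Finset.mem_insert.1 hq with rfl | hq
        · exact le_rfl
        · rcases Finset.mem_union.1 hq with hq | hq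
          · rcases fst_mem_of_mem_labelPositions hq with h | ⟨h, -⟩
            · exact (hg.1 _ (Multiset.mem_add.2 (Or.inl h))).le
            · cases h
          · rcases fst_mem_of_mem_labelPositions hq with h | ⟨-, h⟩
            · exact (hg.1 _ (Multiset.mem_add.2 (Or.inr h))).le
            · exact h.le
      obtain ⟨l', r', h1, h2, h3, h4, h5⟩ := exists_children_insert_left_leaf (ihl .L) (ihr .R)
        hg.2.1 hg.2.2 hg.1 hq hc hlow
      refine ⟨.node a l' r', ⟨?_, h1, h2⟩, ?_, ?_, ?_⟩
      · intro b hb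
        rw [h3, Multiset.mem_cons] at hb
        rcases hb with rfl | hb
        · exact hca
        · exact hg.1 b hb
      · simp only [sideLabels, if_true, add_assoc, h3, Multiset.add_cons]
      · simp only [sideLabels, add_assoc, h4]
      · rw [labelPositions, h5, Finset.insert_comm, labelPositions]
    · obtain ⟨l', r', h1, h2, h3, h4, h5⟩ := exists_children_insert_left_leaf (ihl .L) (ihr .R)
        (x := x) (y := a) hg.2.1 hg.2.2
        (fun b hb => hlt b (mem_sideLabels_node.2 (Or.inr (Multiset.mem_add.1 hb)))) hq hc hlow
      refine ⟨.node a l' r', ⟨?_, h1, h2⟩, ?_, ?_, ?_⟩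
      · intro b hb
        rw [h4] at hb
        exact hg.1 b hb
      · simp only [sideLabels, add_assoc, h3, Multiset.add_cons]
      · simp only [sideLabels, add_assoc, h4]
      · rw [labelPositions, h5, Finset.insert_comm, labelPositions]

/-- The other side. -/
def Side.flip : Side → Side
  | .L => .R
  | .R => .L

/-- The mirror image of a binary tree. -/
def BinaryTree.mirror : BinaryTree ℕ → BinaryTree ℕ
  | .nil => .nil
  | .node a l r => .node a r.mirror l.mirror

theorem sideLabels_mirror (c d : Side) (t : BinaryTree ℕ) :
    sideLabels c.flip d.flip t.mirror = sideLabels c d t := by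
  induction t generalizing d with
  | nil => rfl
  | node a l r ihl ihr =>
    have h1 : sideLabels c.flip .L r.mirror = sideLabels c .R r := ihr .R
    have h2 : sideLabels c.flip .R l.mirror = sideLabels c .L l := ihl .L
    have h3 : d.flip = c.flip ↔ d = c := by cases c <;> cases d <;> simp [Side.flip]
    simp only [BinaryTree.mirror, sideLabels, h1, h2, h3]
    rw [add_right_comm]

theorem ancestorsGreater_mirror (d : Side) (t : BinaryTree ℕ) :
    AncestorsGreater d.flip t.mirror ↔ AncestorsGreater d t := by
  induction t generalizing d with
  | nil => rfl
  | node a l r ihl ihr =>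
    have h1 : sideLabels d.flip .L r.mirror = sideLabels d .R r := sideLabels_mirror d .R r
    have h2 : sideLabels d.flip .R l.mirror = sideLabels d .L l := sideLabels_mirror d .L l
    have h3 : AncestorsGreater .L r.mirror ↔ AncestorsGreater .R r := ihr .R
    have h4 : AncestorsGreater .R l.mirror ↔ AncestorsGreater .L l := ihl .L
    simp only [BinaryTree.mirror, AncestorsGreater, h1, h2, h3, h4]
    rw [add_comm, and_comm (a := AncestorsGreater .R r)]

theorem mem_labelPositions_mirror (d : Side) (t : BinaryTree ℕ) (x y u v : ℕ) :
    (u, v) ∈ labelPositions d.flip y x t.mirror ↔ (v, u) ∈ labelPositions d x y t := by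
  induction t generalizing d x y with
  | nil => cases d <;> simp [labelPositions, BinaryTree.mirror, Side.flip]
  | node a l r ihl ihr =>
    have h1 : ∀ x y, (u, v) ∈ labelPositions .L y x r.mirror ↔
      (v, u) ∈ labelPositions .R x y r := fun x y => ihr .R x y
    have h2 : ∀ x y, (u, v) ∈ labelPositions .R y x l.mirror ↔
      (v, u) ∈ labelPositions .L x y l := fun x y => ihl .L x y
    cases d <;> simp only [labelPositions, BinaryTree.mirror, Side.flip, Finset.mem_insert,
      Finset.mem_union, h1, h2, Prod.mk.injEq] <;> tauto

/-- The case of left leaves is applied to the mirror image, which exchanges the two sides and the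
two coordinates. -/
theorem exists_children_insert_right_leaf {l r : BinaryTree ℕ} {x y : ℕ} {q : ℕ × ℕ} {c : ℕ}
    (hgl : AncestorsGreater .L l) (hgr : AncestorsGreater .R r)
    (hlt : ∀ a ∈ sideLabels .R .L l + sideLabels .R .R r, a < y)
    (hq : q ∈ insert (x, y) (labelPositions .L x y l ∪ labelPositions .R x y r))
    (hc : c < q.2)
    (hlow : ∀ v, (q.1, v) ∈ insert (x, y) (labelPositions .L x y l ∪ labelPositions .R x y r) →
      q.2 ≤ v) :
    ∃ l' r', AncestorsGreater .L l' ∧ AncestorsGreater .R r' ∧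
      sideLabels .L .L l' + sideLabels .L .R r' = sideLabels .L .L l + sideLabels .L .R r ∧
      sideLabels .R .L l' + sideLabels .R .R r' =
        c ::ₘ (sideLabels .R .L l + sideLabels .R .R r) ∧
      labelPositions .L x y l' ∪ labelPositions .R x y r' =
        insert (q.1, c) (labelPositions .L x y l ∪ labelPositions .R x y r) := by
  have hpos : ∀ l r u v, (u, v) ∈ labelPositions .L y x (BinaryTree.mirror r) ∪
      labelPositions .R y x (BinaryTree.mirror l) ↔
      (v, u) ∈ labelPositions .L x y l ∪ labelPositions .R x y r := by
    intro l r u v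
    rw [Finset.mem_union, Finset.mem_union, or_comm]
    exact or_congr (mem_labelPositions_mirror .L l x y u v)
      (mem_labelPositions_mirror .R r x y u v)
  have hpos' : ∀ u v, (u, v) ∈ insert (y, x) (labelPositions .L y x r.mirror ∪
      labelPositions .R y x l.mirror) ↔
      (v, u) ∈ insert (x, y) (labelPositions .L x y l ∪ labelPositions .R x y r) := by
    intro u v
    rw [Finset.mem_insert, Finset.mem_insert, hpos, Prod.mk.injEq, Prod.mk.injEq,
      and_comm (a := u = y)]
  have hlab : ∀ l r (s : Side), sideLabels s.flip .L (BinaryTree.mirror r) +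
      sideLabels s.flip .R (BinaryTree.mirror l) =
      sideLabels s .L l + sideLabels s .R r := by
    intro l r s
    rw [add_comm]
    exact congrArg₂ (· + ·) (sideLabels_mirror s .L l) (sideLabels_mirror s .R r)
  obtain ⟨r', l', h1, h2, h3, h4, h5⟩ := exists_children_insert_left_leaf
    (leftLeafInsertable .L r.mirror) (leftLeafInsertable .R l.mirror) (x := y) (y := x)
    (q := (q.2, q.1)) (c := c) ((ancestorsGreater_mirror .R r).2 hgr)
    ((ancestorsGreater_mirror .L l).2 hgl) (fun a ha => hlt a (hlab l r .R ▸ ha))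
    ((hpos' _ _).2 hq) hc (fun u hu => hlow u ((hpos' _ _).1 hu))
  refine ⟨l'.mirror, r'.mirror, (ancestorsGreater_mirror .R l').2 h2,
    (ancestorsGreater_mirror .L r').2 h1, ?_, ?_, ?_⟩
  · have := hlab r' l' .R
    simp only [Side.flip] at this
    rw [this, h4]
    exact hlab l r .L
  · have := hlab r' l' .L
    simp only [Side.flip] at this
    rw [this, h3]
    exact congrArg _ (hlab l r .R)
  · ext ⟨u, v⟩
    have h6 : (u, v) ∈ labelPositions .L x y l'.mirror ∪ labelPositions .R x y r'.mirror ↔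
        (v, u) ∈ labelPositions .L y x r' ∪ labelPositions .R y x l' := by
      rw [Finset.mem_union, Finset.mem_union, or_comm]
      exact or_congr (mem_labelPositions_mirror .L r' y x u v)
        (mem_labelPositions_mirror .R l' y x u v)
    rw [h6, h5, Finset.mem_insert, Finset.mem_insert, hpos, Prod.mk.injEq, Prod.mk.injEq,
      and_comm (a := v = c)]

end LeafInsertion

/-! ### From grown point sets back to trees. -/

section Surjectivity

variable {m n : ℕ}

/-- Label coordinates of a row or column. -/
def toLabel (k : ℕ) (i : Fin k) : ℕ := k - i.val

theorem toLabel_injective (k : ℕ) : Function.Injective (toLabel k) := by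
  intro i j h
  have hi := i.isLt
  have hj := j.isLt
  simp only [toLabel] at h
  exact Fin.ext (by omega)

theorem toLabel_lt {k : ℕ} {i j : Fin k} (h : i < j) : toLabel k j < toLabel k i := by
  have hj := j.isLt
  rw [Fin.lt_def] at h
  simp only [toLabel]
  omega

theorem toLabel_le {k : ℕ} {i j : Fin k} (h : i ≤ j) : toLabel k j ≤ toLabel k i :=
  Nat.sub_le_sub_left h k

theorem image_toLabel_erase_insert {k : ℕ} {i₀ i : Fin k} {S : Finset (Fin k)} (h₀ : i₀ ∈ S)
    (hi : i ∉ S) : (((insert i S).erase i₀).image (toLabel k)).val =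
      toLabel k i ::ₘ ((S.erase i₀).image (toLabel k)).val := by
  have hne : i ≠ i₀ := fun h => hi (h ▸ h₀)
  rw [Finset.erase_insert_of_ne hne, Finset.image_insert, Finset.insert_val_of_notMem]
  intro hmem
  obtain ⟨j, hj, hji⟩ := Finset.mem_image.1 hmem
  exact hi (toLabel_injective k hji ▸ (Finset.mem_erase.1 hj).2)

theorem toLabel_lt_of_mem_image_erase {k : ℕ} {i₀ : Fin k} (h₀ : i₀.val = 0)
    {S : Finset (Fin k)} {a : ℕ} (ha : a ∈ ((S.erase i₀).image (toLabel k)).val) : a < k := by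
  obtain ⟨j, hj, rfl⟩ := Finset.mem_image.1 (show a ∈ Finset.image _ _ from ha)
  have h1 := j.isLt
  have h2 : j.val ≠ i₀.val := fun h => (Finset.mem_erase.1 hj).1 (Fin.ext h)
  simp only [toLabel]
  omega

/-- Every grown point set is the point set of a labelled tree. -/
theorem Grown.exists_children {x₀ : Fin m} {y₀ : Fin n} (hx₀ : x₀.val = 0) (hy₀ : y₀.val = 0)
    {A : Finset (Fin m × Fin n)} {σ : Equiv.Perm (BorderEdge m n)} {X : Finset (Fin m)}
    {Y : Finset (Fin n)} (h : Grown x₀ y₀ A σ X Y) :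
    ∃ l r, AncestorsGreater .L l ∧ AncestorsGreater .R r ∧
      sideLabels .L .L l + sideLabels .L .R r = ((X.erase x₀).image (toLabel m)).val ∧
      sideLabels .R .L l + sideLabels .R .R r = ((Y.erase y₀).image (toLabel n)).val ∧
      insert (m, n) (labelPositions .L m n l ∪ labelPositions .R m n r) =
        A.image (Prod.map (toLabel m) (toLabel n)) := by
  have hinj := (toLabel_injective m).prodMap (toLabel_injective n)
  -- Labels refer to the final rectangle, so existing labels never change as leaves are added; they
  -- need not fill an interval before the end.
  induction h with
  | root =>
    refine ⟨.nil, .nil, trivial, trivial, by simp [sideLabels], by simp [sideLabels], ?_⟩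
    simp [labelPositions, toLabel, hx₀, hy₀]
  | @row A σ X Y x y h hx hy ih =>
    obtain ⟨l, r, h1, h2, h3, h4, h5⟩ := ih
    -- The new left leaf hangs from the lowest point of column `y`.
    obtain ⟨z, hzA, hzmax⟩ : ∃ z, (z, y) ∈ A ∧ ∀ w, (w, y) ∈ A → w ≤ z := by
      obtain ⟨z, hz⟩ := h.exists_mem_column y hy
      have hne : (Finset.univ.filter fun z => (z, y) ∈ A).Nonempty := ⟨z, by simp [hz]⟩
      refine ⟨_, (Finset.mem_filter.1 (Finset.max'_mem _ hne)).2, fun w hw => ?_⟩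
      exact Finset.le_max' _ _ (by simp [hw])
    obtain ⟨l', r', g1, g2, g3, g4, g5⟩ := exists_children_insert_left_leaf
      (leftLeafInsertable .L l) (leftLeafInsertable .R r) (x := m) (y := n)
      (q := (toLabel m z, toLabel n y)) (c := toLabel m x) h1 h2
      (fun a ha => toLabel_lt_of_mem_image_erase hx₀ (h3 ▸ ha))
      (by rw [h5]; exact Finset.mem_image_of_mem _ hzA)
      (toLabel_lt (hx z (h.mem_support _ hzA).1))
      (by
        intro u hu
        rw [h5] at hu
        obtain ⟨⟨w, v⟩, hwA, hw⟩ := Finset.mem_image.1 hu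
        simp only [Prod.map_apply, Prod.mk.injEq] at hw
        obtain rfl := toLabel_injective n hw.2
        rw [← hw.1]
        exact toLabel_le (hzmax w hwA))
    refine ⟨l', r', g1, g2, ?_, ?_, ?_⟩
    · rw [g3, h3, image_toLabel_erase_insert h.root_mem_support.1 fun hmem =>
        lt_irrefl _ (hx x hmem)]
    · rw [g4, h4]
    · rw [g5, Finset.insert_comm, h5, Finset.image_insert]
      rfl
  | @column A σ X Y x y h hxX hx hy hlast ih =>
    obtain ⟨l, r, h1, h2, h3, h4, h5⟩ := ih
    -- The new right leaf hangs from the rightmost point of row `x`.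
    obtain ⟨z, hzA, hzmax⟩ : ∃ z, (x, z) ∈ A ∧ ∀ w, (x, w) ∈ A → w ≤ z := by
      obtain ⟨z, hz⟩ := h.exists_mem_row x hxX
      have hne : (Finset.univ.filter fun z => (x, z) ∈ A).Nonempty := ⟨z, by simp [hz]⟩
      refine ⟨_, (Finset.mem_filter.1 (Finset.max'_mem _ hne)).2, fun w hw => ?_⟩
      exact Finset.le_max' _ _ (by simp [hw])
    obtain ⟨l', r', g1, g2, g3, g4, g5⟩ := exists_children_insert_right_leaf (x := m) (y := n)
      (q := (toLabel m x, toLabel n z)) (c := toLabel n y) h1 h2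
      (fun a ha => toLabel_lt_of_mem_image_erase hy₀ (h4 ▸ ha))
      (by rw [h5]; exact Finset.mem_image_of_mem _ hzA)
      (toLabel_lt (hlast z hzA))
      (by
        intro u hu
        rw [h5] at hu
        obtain ⟨⟨w, v⟩, hwA, hw⟩ := Finset.mem_image.1 hu
        simp only [Prod.map_apply, Prod.mk.injEq] at hw
        obtain rfl := toLabel_injective m hw.1
        rw [← hw.2]
        exact toLabel_le (hzmax v hwA))
    refine ⟨l', r', g1, g2, ?_, ?_, ?_⟩
    · rw [g3, h3]
    · rw [g4, h4, image_toLabel_erase_insert h.root_mem_support.2 hy]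
    · rw [g5, Finset.insert_comm, h5, Finset.image_insert]
      rfl

theorem image_toLabel_univ_erase {k : ℕ} {i₀ : Fin k} (h₀ : i₀.val = 0) :
    (Finset.univ.erase i₀).image (toLabel k) = Finset.Icc 1 (k - 1) := by
  ext a
  simp only [Finset.mem_image, Finset.mem_erase, Finset.mem_univ, and_true, Finset.mem_Icc,
    toLabel]
  constructor
  · rintro ⟨j, hj, rfl⟩
    have h1 := j.isLt
    have h2 : j.val ≠ i₀.val := fun h => hj (Fin.ext h)
    omega
  · intro ha
    refine ⟨⟨k - a, by omega⟩, fun h => ?_, by simp only; omega⟩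
    have := congrArg Fin.val h
    simp only at this
    omega

theorem Grown.exists_tree {x₀ : Fin m} {y₀ : Fin n} (hx₀ : x₀.val = 0) (hy₀ : y₀.val = 0)
    {A : Finset (Fin m × Fin n)} {σ : Equiv.Perm (BorderEdge m n)}
    (h : Grown x₀ y₀ A σ Finset.univ Finset.univ) :
    ∃ T : NonAmbiguousTree, T.wL = m ∧ T.wR = n ∧ T.cells m n = A := by
  obtain ⟨l, r, h1, h2, h3, h4, h5⟩ := h.exists_children hx₀ hy₀
  rw [image_toLabel_univ_erase hx₀] at h3
  rw [image_toLabel_univ_erase hy₀] at h4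
  have hm := x₀.isLt
  have hn := y₀.isLt
  have hL : (sideLabels .L .L l + sideLabels .L .R r).card = m - 1 := by
    rw [h3, Finset.card_val, Nat.card_Icc]
    omega
  have hR : (sideLabels .R .L l + sideLabels .R .R r).card = n - 1 := by
    rw [h4, Finset.card_val, Nat.card_Icc]
    omega
  let T : NonAmbiguousTree :=
    { left := l
      right := r
      leftLabels_eq := by rw [hL, h3]
      rightLabels_eq := by rw [hR, h4]
      left_greater := h1
      right_greater := h2 }
  have hwL : T.wL = m := by
    rw [NonAmbiguousTree.wL, hL]
    omega
  have hwR : T.wR = n := by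
    rw [NonAmbiguousTree.wR, hR]
    omega
  have hP : T.points = A.image (Prod.map (toLabel m) (toLabel n)) := by
    rw [NonAmbiguousTree.points, hwL, hwR]
    exact h5
  refine ⟨T, hwL, hwR, ?_⟩
  -- With `T` opaque, `m` and `n` can be replaced by its two sizes, as `mem_cells` requires.
  clear_value T
  subst hwL hwR
  ext p
  rw [NonAmbiguousTree.mem_cells, hP]
  exact ((toLabel_injective _).prodMap (toLabel_injective _)).mem_finset_image (a := p)

end Surjectivity

/-! ### The two bijections, in border numbers and in coloured integers. -/

theorem isBorderCycle_univ_iff {m n : ℕ} {σ : Perm (BorderEdge m n)} :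
    IsBorderCycle σ Finset.univ Finset.univ ↔ (∀ e e', SameCycle σ e e') ∧
      (∀ y y', σ (.south y) = .south y' → y < y') ∧
        ∀ x x', σ (.east x) = .east x' → x < x' := by
  have huniv : ∀ e : BorderEdge m n, borderEdges Finset.univ Finset.univ e := by
    rintro (y | x) <;> simp
  exact ⟨fun h => ⟨fun e e' => h.sameCycle e e' (huniv e) (huniv e'),
    fun y => h.south_lt y (Finset.mem_univ y), fun x => h.east_lt x (Finset.mem_univ x)⟩,
    fun h => ⟨fun e he => absurd (huniv e) he, fun e e' _ _ => h.1 e e',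
      fun y _ => h.2.1 y, fun x _ => h.2.2 x⟩⟩

/-- Non-ambiguous trees are in bijection with border cycles. -/
theorem bijOn_zigzagImage {m n : ℕ} (hm : 0 < m) (hn : 0 < n) :
    Set.BijOn (fun T => zigzagImage (T.cells m n))
      {T : NonAmbiguousTree | T.wL = m ∧ T.wR = n}
      {f | ∃ σ : Perm (BorderEdge m n), ⇑σ = f ∧ IsBorderCycle σ Finset.univ Finset.univ} := by
  have hgrown : ∀ T : NonAmbiguousTree, T.wL = m → T.wR = n →
      ∃ σ, Grown ⟨0, hm⟩ ⟨0, hn⟩ (T.cells m n) σ Finset.univ Finset.univ := by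
    rintro T rfl rfl
    exact T.isNonAmbiguous.exists_grown _ rfl
  refine ⟨?_, ?_, ?_⟩
  · rintro T ⟨hL, hR⟩
    obtain ⟨σ, hσ⟩ := hgrown T hL hR
    exact ⟨σ, funext fun e => (hσ.zigzagImage_eq e).symm, hσ.isBorderCycle⟩
  · rintro T ⟨hL, hR⟩ T' ⟨hL', hR'⟩ h
    obtain ⟨σ, hσ⟩ := hgrown T hL hR
    obtain ⟨τ, hτ⟩ := hgrown T' hL' hR'
    have : σ = τ := by
      ext e
      rw [← hσ.zigzagImage_eq e, ← hτ.zigzagImage_eq e]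
      exact congrFun h e
    subst this
    exact NonAmbiguousTree.eq_of_cells_eq hL hR hL' hR' (Grown.eq_of_grown _ rfl hσ hτ)
  · rintro _ ⟨σ, rfl, h⟩
    obtain ⟨A, hA⟩ := h.exists_grown (x₀ := ⟨0, hm⟩) (y₀ := ⟨0, hn⟩) _ rfl (Finset.mem_univ _)
      (Finset.mem_univ _) (fun _ _ => Nat.zero_le _) fun _ _ => Nat.zero_le _
    obtain ⟨T, hL, hR, hT⟩ := hA.exists_tree rfl rfl
    refine ⟨T, ⟨hL, hR⟩, funext fun e => ?_⟩
    simp only [hT]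
    exact hA.zigzagImage_eq e

/-- Conjugation by `e` is a bijection between the self-maps of `α` and those of `β` and preserves
permutations, so one bijection onto border cycles yields both claims. -/
theorem Set.BijOn.permCongr {ι α β : Type*} {S : Set ι} {F : ι → α → α} {p : Perm α → Prop}
    {q : Perm β → Prop} (h : Set.BijOn F S {f | ∃ σ : Perm α, ⇑σ = f ∧ p σ}) (e : α ≃ β)
    (hpq : ∀ σ : Perm α, p σ ↔ q (e.permCongr σ)) :
    Set.BijOn (fun T => e ∘ F T ∘ e.symm) S {f | ∃ σ : Perm β, ⇑σ = f ∧ q σ} := by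
  refine ⟨?_, ?_, ?_⟩
  · intro T hT
    obtain ⟨σ, hσ, hp⟩ := h.mapsTo hT
    refine ⟨e.permCongr σ, ?_, (hpq σ).1 hp⟩
    ext b
    simp [← hσ, permCongr_apply]
  · intro T hT T' hT' hTT'
    refine h.injOn hT hT' (funext fun a => ?_)
    simpa using congrFun hTT' (e a)
  · rintro _ ⟨τ, rfl, hq⟩
    obtain ⟨T, hT, hTe⟩ := h.surjOn (a := ⇑(e.permCongr.symm τ)) ⟨_, rfl, (hpq _).2 (by rwa [apply_symm_apply])⟩
    refine ⟨T, hT, ?_⟩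
    ext b
    simp [hTe, permCongr_symm, permCongr_apply]

theorem isCycleOn_univ_iff {α : Type*} {σ : Perm α} :
    σ.IsCycleOn Set.univ ↔ ∀ e e', SameCycle σ e e' :=
  ⟨fun h e e' => h.2 (Set.mem_univ e) (Set.mem_univ e'),
    fun h => ⟨Set.bijOn_univ.2 σ.bijective, fun e _ e' _ => h e e'⟩⟩

theorem isCycleOn_univ_permCongr {α β : Type*} (e : α ≃ β) (σ : Perm α) :
    (e.permCongr σ).IsCycleOn Set.univ ↔ ∀ a a', SameCycle σ a a' := by
  rw [isCycleOn_univ_iff]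
  constructor
  · intro h a a'
    simpa using (h (e a) (e a')).map (g := σ) (π := e.symm) fun b => by
      simpa [permCongr_apply] using sameCycle_apply_right.2 (SameCycle.refl σ (e.symm b))
  · intro h b b'
    simpa using (h (e.symm b) (e.symm b')).map (g := e.permCongr σ) (π := e) fun a => by
      have := sameCycle_apply_right.2 (SameCycle.refl (e.permCongr σ) (e a))
      simpa [permCongr_apply] using this

theorem borderNumber_south {m n : ℕ} (y : Fin n) :
    (borderNumber m n (.south y)).val = y.val := rfl

theorem borderNumber_east {m n : ℕ} (x : Fin m) :
    (borderNumber m n (.east x)).val = n + (m - 1 - x.val) := rfl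

/-- In terms of border numbers, border cycles are the cycles with excedance positions
`0, …, n - 1`. -/
theorem isBorderCycle_iff_excedances {m n : ℕ} (hn : 0 < n) (σ : Perm (BorderEdge m n)) :
    IsBorderCycle σ Finset.univ Finset.univ ↔
      ((borderNumber m n).permCongr σ).IsCycleOn Set.univ ∧
        {i | i < (borderNumber m n).permCongr σ i} = {i | i.val < n} := by
  rw [isBorderCycle_univ_iff, isCycleOn_univ_permCongr]
  refine and_congr_right fun hcyc => ?_
  have hset : {i | i < (borderNumber m n).permCongr σ i} = {i | i.val < n} ↔
      ∀ e, (borderNumber m n e < borderNumber m n (σ e) ↔ (borderNumber m n e).val < n) := by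
    rw [Set.ext_iff, ← (borderNumber m n).forall_congr_right]
    simp [permCongr_apply]
  rw [hset]
  constructor
  · rintro ⟨hs, he⟩ (y | x)
    · have hy := y.isLt
      rw [Fin.lt_def, borderNumber_south]
      cases h : σ (.south y) with
      | south y' =>
        have := hs y y' h
        rw [Fin.lt_def] at this
        rw [borderNumber_south]
        omega
      | east x' =>
        rw [borderNumber_east]
        omega
    · have hx := x.isLt
      rw [Fin.lt_def, borderNumber_east]
      cases h : σ (.east x) with
      | south y' =>
        have hy' := y'.isLt
        rw [borderNumber_south]
        omega
      | east x' =>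
        have := he x x' h
        rw [Fin.lt_def] at this
        rw [borderNumber_east]
        omega
  · intro hexc
    constructor
    · intro y y' h
      have := (hexc (.south y)).2 y.isLt
      rwa [h, Fin.lt_def, borderNumber_south, borderNumber_south] at this
    · intro x x' h
      -- Not being an excedance gives only a weak inequality. A fixed row edge would be a whole
      -- cycle, but there is also a column edge as `0 < n`.
      have hne : x ≠ x' := by
        rintro rfl
        have := (hcyc (.east x) (.south ⟨0, hn⟩)).eq_of_left h
        cases this
      have := mt (hexc (.east x)).1 (by rw [borderNumber_east]; omega)
      rw [h, Fin.lt_def, borderNumber_east, borderNumber_east] at this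
      have hx := x.isLt
      have hx' := x'.isLt
      have hne' : x.val ≠ x'.val := fun h' => hne (Fin.ext h')
      rw [Fin.lt_def]
      omega

/-- Blue integers count columns from the right and red ones count rows from the bottom, so moves to
the right or downwards within a colour become decreases. -/
theorem recolour_borderNumber_south {m n : ℕ} (y : Fin n) :
    recolour m n (borderNumber m n (.south y)) = .blue y.rev := by
  have h := y.isLt
  rw [← eq_symm_apply]
  exact Fin.ext (show y.val = n - (n - (y.val + 1) + 1) by omega)

theorem recolour_borderNumber_east {m n : ℕ} (x : Fin m) :
    recolour m n (borderNumber m n (.east x)) = .red x.rev := by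
  have h := x.isLt
  rw [← eq_symm_apply]
  exact Fin.ext (show n + (m - 1 - x.val) = n + (m - (x.val + 1)) by omega)

/-- In terms of coloured integers, border cycles are the block-decreasing cycles. -/
theorem isBorderCycle_iff_isBlockDecreasingCycle {m n : ℕ} (σ : Perm (BorderEdge m n)) :
    IsBorderCycle σ Finset.univ Finset.univ ↔
      IsBlockDecreasingCycle (((borderNumber m n).trans (recolour m n)).permCongr σ) := by
  rw [isBorderCycle_univ_iff, IsBlockDecreasingCycle, isCycleOn_univ_permCongr]
  refine and_congr_right fun _ => ?_
  set e := (borderNumber m n).trans (recolour m n)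
  have hs : ∀ y : Fin n, e (.south y) = .blue y.rev := recolour_borderNumber_south
  have hE : ∀ x : Fin m, e (.east x) = .red x.rev := recolour_borderNumber_east
  have hs' : ∀ y : Fin n, e.symm (.blue y) = .south y.rev := fun y => by
    rw [symm_apply_eq, hs, Fin.rev_rev]
  have hE' : ∀ y : Fin m, e.symm (.red y) = .east y.rev := fun y => by
    rw [symm_apply_eq, hE, Fin.rev_rev]
  have hblue : ∀ a b : Fin n, e.permCongr σ (.blue a) = .blue b ↔
      σ (.south a.rev) = .south b.rev := fun a b => by
    rw [permCongr_apply, hs', ← hs' b, eq_symm_apply]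
  have hred : ∀ a b : Fin m, e.permCongr σ (.red a) = .red b ↔
      σ (.east a.rev) = .east b.rev := fun a b => by
    rw [permCongr_apply, hE', ← hE' b, eq_symm_apply]
  simp only [hblue, hred]
  rw [and_comm]
  refine and_congr ⟨fun h a b hab => Fin.rev_lt_rev.1 (h _ _ hab), fun h a b hab => ?_⟩
    ⟨fun h a b hab => Fin.rev_lt_rev.1 (h _ _ hab), fun h a b hab => ?_⟩
  · exact Fin.rev_lt_rev.1 (h a.rev b.rev (by simpa using hab))
  · exact Fin.rev_lt_rev.1 (h a.rev b.rev (by simpa using hab))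

theorem mainTheorem12 (wL wR : ℕ) (hL : 0 < wL) (hR : 0 < wR) :
    Set.BijOn (psi wL wR)
      {T : NonAmbiguousTree | T.wL = wL ∧ T.wR = wR}
      {f : Fin (wL + wR) → Fin (wL + wR) |
        ∃ σ : Equiv.Perm (Fin (wL + wR)), ⇑σ = f ∧ σ.IsCycleOn Set.univ ∧
          {i | i < σ i} = {i | i.val < wR}} ∧
    Set.BijOn (fun T => recolour wL wR ∘ psi wL wR T ∘ (recolour wL wR).symm)
      {T : NonAmbiguousTree | T.wL = wL ∧ T.wR = wR}
      {f : Coloured wL wR → Coloured wL wR |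
        ∃ σ : Equiv.Perm (Coloured wL wR), ⇑σ = f ∧ IsBlockDecreasingCycle σ} :=
  ⟨(bijOn_zigzagImage hL hR).permCongr (borderNumber wL wR) (isBorderCycle_iff_excedances hR),
    (bijOn_zigzagImage hL hR).permCongr ((borderNumber wL wR).trans (recolour wL wR))
      isBorderCycle_iff_isBlockDecreasingCycle⟩
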